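/- For a nonnegative integer $n$, let $\omega(n)$ denote the number of $(x_1,x_2,x_3,y_1,y_2,y_3)\in\mathbb{Z}^6$ with $n=x_1^2+x_2^2+x_3^2+3y_1^2+3y_2^2+3y_3^2$. A partition is called a $3$-core if none of its hook numbers is a multiple of $3$ (the empty partition, the unique partition of $0$, is a $3$-core). Let $B_3(n)$ denote the number of ordered triples $(\lambda_1,\lambda_2,\lambda_3)$ of partitions, each of which is a $3$-core, such that the sum of all the parts of $\lambda_1,\lambda_2,\lambda_3$ equals $n$. Then, for every integer $n\ge 0$, $$\omega(12n+2)=12\,B_3(6n).$$ -/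

import Mathlib

/-- The hook number of the cell `c = (i, j)` of a Young diagram: the arm length, plus the leg
length, plus one (for the cell itself). For a cell of `μ` the subtractions do not truncate. -/
def hookNumber (μ : YoungDiagram) (c : ℕ × ℕ) : ℕ :=
  (μ.rowLen c.1 - (c.2 + 1)) + (μ.colLen c.2 - (c.1 + 1)) + 1

/-- A partition, given as its Young diagram (the parts are the row lengths, see
`YoungDiagram.equivListRowLens`), is a `t`-core if none of its hook numbers is a multiple
of `t`. -/
def IsTCore (t : ℕ) (μ : YoungDiagram) : Prop :=
  ∀ c ∈ μ.cells, ¬ t ∣ hookNumber μ c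

/-- The set of partition triples of `n` with `t`-cores: ordered triples of `t`-core partitions
such that the sum of all the parts (that is, the total number of cells) is `n`. -/
def coreTriples (t n : ℕ) : Set (Fin 3 → YoungDiagram) :=
  {p | (∑ i, (p i).card) = n ∧ ∀ i, IsTCore t (p i)}

/-- `B_t(n)`: the number of partition triples of `n` with `t`-cores. -/
noncomputable def coreTripleCount (t n : ℕ) : ℕ :=
  (coreTriples t n).ncard

/-- The set of representations of `n` in the form
`x₁² + x₂² + x₃² + 3 y₁² + 3 y₂² + 3 y₃²` with integers `xᵢ`, `yᵢ`. -/
def formRepresentations (n : ℕ) : Set ((Fin 3 → ℤ) × (Fin 3 → ℤ)) :=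
  {v | v.1 0 ^ 2 + v.1 1 ^ 2 + v.1 2 ^ 2
      + 3 * v.2 0 ^ 2 + 3 * v.2 1 ^ 2 + 3 * v.2 2 ^ 2 = (n : ℤ)}

/-- `ω(n)`: the number of representations of `n` in the form
`x₁² + x₂² + x₃² + 3 y₁² + 3 y₂² + 3 y₃²`. -/
noncomputable def formRepresentationCount (n : ℕ) : ℕ :=
  (formRepresentations n).ncard

/-! Write A(k), C(k) for `thetaA k`, `thetaC k`, and [q^n] for the coefficient of q^n. Both sides
become multiples of c = [q^(6n+1)] A(3)²C(1). Cores: 3-cores are parametrized by pairs of naturals,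
and a symmetry of order three gives C(1) = 3 ∑ q^(3|μ|+1). Hence 27 B_3(6n) = [q^(18n+3)] C(1)³,
which is 9c by the cubic identity `thetaC_pow_three`. Form: the even part of (∑ q^(x²+3y²))³ is
A(2)²A(4) by `thetaA_two_sq`, so ω(12n+2) = [q^(6n+1)] A(1)²A(2). Substitute A(k) = A(3k) + 2C(k)
and keep exponents 1 mod 3: what remains is 4C(1)(A(3)A(6) + 2C(1)C(2)). By `thetaC_mul_form_eq`
this is 4A(3)²C(1) + 16A(6)C(2)², whose last term has only even exponents. So ω(12n+2) = 4c = 12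
B_3(6n). The identity `thetaC_mul_form_eq` rests on 2C(2k)² = (A(3k) - A(6k))C(k) and C(k)² =
C(2k)(A(3k) + 2A(6k)). These are proved by descent: the defects `quadF k` and `quadG k`, multiplied
by C(2k) and C(k), are combinations of the defects at 3k, which forces their order of vanishing at q
= 0 to be infinite. -/

open PowerSeries

/-! ### Generating functions of weighted sets. -/

/-- The generating function of a set `S` with respect to an integer weight `N`. -/
noncomputable def theta {ι : Type*} (S : Set ι) (N : ι → ℤ) : PowerSeries ℚ :=
  PowerSeries.mk fun n => (({i ∈ S | N i = (n : ℤ)} : Set ι).ncard : ℚ)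

/-- A weight is admissible if it is nonnegative and takes each value finitely often. -/
def AdmissibleWeight {ι : Type*} (N : ι → ℤ) : Prop :=
  (∀ i, 0 ≤ N i) ∧ ∀ n : ℤ, {i | N i = n}.Finite

theorem coeff_theta {ι : Type*} (S : Set ι) (N : ι → ℤ) (n : ℕ) :
    coeff n (theta S N) = (({i ∈ S | N i = (n : ℤ)} : Set ι).ncard : ℚ) := by
  simp [theta]

theorem AdmissibleWeight.finite {ι : Type*} {N : ι → ℤ} (hN : AdmissibleWeight N) (S : Set ι)
    (n : ℤ) : {i ∈ S | N i = n}.Finite :=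
  (hN.2 n).subset fun _ h => h.2

theorem AdmissibleWeight.finite_Icc {ι : Type*} {N : ι → ℤ} (hN : AdmissibleWeight N) (n : ℤ) :
    {i | N i ≤ n}.Finite := by
  refine ((Set.finite_Icc (0 : ℤ) n).biUnion fun m _ => hN.2 m).subset fun i hi => ?_
  simp only [Set.mem_iUnion, Set.mem_ofPred_eq]
  exact ⟨N i, ⟨hN.1 i, hi⟩, rfl⟩

theorem AdmissibleWeight.add {ι κ : Type*} {N : ι → ℤ} {M : κ → ℤ}
    (hN : AdmissibleWeight N) (hM : AdmissibleWeight M) :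
    AdmissibleWeight fun p : ι × κ => N p.1 + M p.2 := by
  refine ⟨fun p => add_nonneg (hN.1 _) (hM.1 _), fun n => ?_⟩
  refine ((hN.finite_Icc n).prod (hM.finite_Icc n)).subset fun p hp => ?_
  have h1 := hN.1 p.1
  have h2 := hM.1 p.2
  simp only [Set.mem_ofPred_eq] at hp
  constructor <;> simp only [Set.mem_ofPred_eq] <;> linarith

theorem AdmissibleWeight.const_mul {ι : Type*} {N : ι → ℤ} (hN : AdmissibleWeight N) {k : ℤ}
    (hk : 0 < k) : AdmissibleWeight fun i => k * N i := by
  refine ⟨fun i => mul_nonneg hk.le (hN.1 i), fun n => ?_⟩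
  refine (hN.2 (n / k)).subset fun i hi => ?_
  simp only [Set.mem_ofPred_eq] at hi ⊢
  rw [← hi, Int.mul_ediv_cancel_left _ hk.ne']

/-- Weight-preserving bijections do not change the generating function. -/
theorem theta_congr {ι κ : Type*} {S : Set ι} {T : Set κ} {N : ι → ℤ} {M : κ → ℤ}
    (f : ι → κ) (g : κ → ι) (hf : ∀ i ∈ S, f i ∈ T) (hg : ∀ j ∈ T, g j ∈ S)
    (hgf : ∀ i ∈ S, g (f i) = i) (hfg : ∀ j ∈ T, f (g j) = j) (hN : ∀ i ∈ S, M (f i) = N i) :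
    theta S N = theta T M := by
  ext n
  rw [coeff_theta, coeff_theta]
  congr 1
  refine Set.ncard_congr (fun i _ => f i) ?_ ?_ ?_
  · rintro i ⟨hi, h⟩
    exact ⟨hf i hi, by rw [hN i hi, h]⟩
  · rintro i j ⟨hi, _⟩ ⟨hj, _⟩ h
    rw [← hgf i hi, h, hgf j hj]
  · rintro j ⟨hj, h⟩
    exact ⟨g j, ⟨hg j hj, by rw [← hN _ (hg j hj), hfg j hj, h]⟩, hfg j hj⟩

theorem theta_mul {ι κ : Type*} {N : ι → ℤ} {M : κ → ℤ} (hN : AdmissibleWeight N)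
    (hM : AdmissibleWeight M) (S : Set ι) (T : Set κ) :
    theta S N * theta T M = theta (S ×ˢ T) fun p => N p.1 + M p.2 := by
  ext n
  rw [coeff_mul, coeff_theta]
  simp only [coeff_theta]
  have hset : {p ∈ S ×ˢ T | N p.1 + M p.2 = (n : ℤ)} =
      ⋃ x ∈ Finset.HasAntidiagonal.antidiagonal n, {i ∈ S | N i = (x.1 : ℤ)} ×ˢ {j ∈ T | M j = (x.2 : ℤ)} := by
    ext ⟨i, j⟩
    simp only [Set.mem_ofPred_eq, Set.mem_prod, Set.mem_iUnion, Finset.HasAntidiagonal.mem_antidiagonal,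
      exists_prop, Prod.exists]
    constructor
    · rintro ⟨⟨hi, hj⟩, h⟩
      refine ⟨(N i).toNat, (M j).toNat, ?_, ⟨hi, ?_⟩, hj, ?_⟩ <;>
      · have := hN.1 i
        have := hM.1 j
        omega
    · rintro ⟨a, b, hab, ⟨hi, ha⟩, hj, hb⟩
      exact ⟨⟨hi, hj⟩, by omega⟩
  rw [hset, Set.ncard_eq_toFinset_card _ (by
    refine Set.Finite.biUnion (Finset.finite_toSet _) fun x _ => ?_
    exact (hN.finite _ _).prod (hM.finite _ _))]
  have hcard : ∀ x : ℕ × ℕ,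
      (({i ∈ S | N i = (x.1 : ℤ)} ×ˢ {j ∈ T | M j = (x.2 : ℤ)} : Set (ι × κ)).ncard : ℚ) =
      ({i ∈ S | N i = (x.1 : ℤ)}.ncard : ℚ) * ({j ∈ T | M j = (x.2 : ℤ)}.ncard : ℚ) := by
    intro x
    rw [Set.ncard_prod, Nat.cast_mul]
  simp only [← hcard]
  classical
  rw [← Nat.cast_sum, Nat.cast_inj]
  have hfin : ∀ x : ℕ × ℕ,
      ({i ∈ S | N i = (x.1 : ℤ)} ×ˢ {j ∈ T | M j = (x.2 : ℤ)} : Set (ι × κ)).Finite :=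
    fun x => (hN.finite _ _).prod (hM.finite _ _)
  simp only [fun x => Set.ncard_eq_toFinset_card _ (hfin x)]
  rw [← Finset.card_biUnion]
  · congr 1
    ext p
    simp only [Set.Finite.mem_toFinset, Set.mem_iUnion, Finset.mem_biUnion, exists_prop]
  · intro x _ y _ hxy
    rw [Function.onFun, Finset.disjoint_left]
    intro p hp hp'
    simp only [Set.Finite.mem_toFinset, Set.mem_prod, Set.mem_ofPred_eq] at hp hp'
    apply hxy
    ext <;> omega

theorem theta_union {ι : Type*} {N : ι → ℤ} (hN : AdmissibleWeight N) {S T : Set ι}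
    (h : Disjoint S T) : theta (S ∪ T) N = theta S N + theta T N := by
  ext n
  rw [map_add, coeff_theta, coeff_theta, coeff_theta, ← Nat.cast_add, Nat.cast_inj,
    ← Set.ncard_union_eq _ (hN.finite S n) (hN.finite T n)]
  · congr 1
    ext i
    simp only [Set.mem_ofPred_eq, Set.mem_union]
    tauto
  · exact h.mono (fun _ h => h.1) fun _ h => h.1

theorem coeff_theta_eq_zero {ι : Type*} {S : Set ι} {N : ι → ℤ} {n : ℕ}
    (h : ∀ i ∈ S, N i ≠ n) : coeff n (theta S N) = 0 := by
  rw [coeff_theta, Nat.cast_eq_zero]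
  convert Set.ncard_empty ι
  ext i
  simpa using h i

theorem coeff_theta_const_mul {ι : Type*} (S : Set ι) (N : ι → ℤ) {k : ℕ} (hk : 0 < k) (n : ℕ) :
    coeff (k * n) (theta S fun i => k * N i) = coeff n (theta S N) := by
  rw [coeff_theta, coeff_theta]
  congr 2
  ext i
  simp [hk.ne']

theorem theta_mul_mul {ι κ μ : Type*} {N : ι → ℤ} {M : κ → ℤ} {P : μ → ℤ}
    (hN : AdmissibleWeight N) (hM : AdmissibleWeight M) (hP : AdmissibleWeight P)
    (S : Set ι) (T : Set κ) (U : Set μ) :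
    theta S N * theta T M * theta U P =
      theta (S ×ˢ T ×ˢ U) fun p => N p.1 + M p.2.1 + P p.2.2 := by
  rw [mul_assoc, theta_mul hM hP, theta_mul hN (hM.add hP)]
  simp only [add_assoc]

theorem coeff_theta_mul_mul_eq_zero {ι κ μ : Type*} {N : ι → ℤ} {M : κ → ℤ} {P : μ → ℤ}
    (hN : AdmissibleWeight N) (hM : AdmissibleWeight M) (hP : AdmissibleWeight P)
    {S : Set ι} {T : Set κ} {U : Set μ} {n : ℕ}
    (h : ∀ i ∈ S, ∀ j ∈ T, ∀ k ∈ U, N i + M j + P k ≠ n) :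
    coeff n (theta S N * theta T M * theta U P) = 0 := by
  rw [theta_mul_mul hN hM hP]
  exact coeff_theta_eq_zero fun p hp => h _ hp.1 _ hp.2.1 _ hp.2.2

theorem theta_split_mod_three {ι : Type*} {N : ι → ℤ} (hN : AdmissibleWeight N) (S : Set ι)
    (f : ι → ℤ) :
    theta S N = theta {i ∈ S | f i % 3 = 0} N + theta {i ∈ S | f i % 3 = 1} N +
      theta {i ∈ S | f i % 3 = 2} N := by
  rw [← theta_union hN, ← theta_union hN]
  · congr 1
    ext i
    simp only [Set.mem_union, Set.mem_ofPred_eq]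
    have : f i % 3 = 0 ∨ f i % 3 = 1 ∨ f i % 3 = 2 := by omega
    tauto
  · rw [Set.disjoint_left]
    rintro i (⟨_, h⟩ | ⟨_, h⟩) ⟨_, h'⟩ <;> omega
  · rw [Set.disjoint_left]
    rintro i ⟨_, h⟩ ⟨_, h'⟩
    omega

theorem charZero_powerSeries_rat : CharZero ℚ⟦X⟧ :=
  charZero_of_injective_algebraMap (R := ℚ) (algebraMap ℚ ℚ⟦X⟧).injective

theorem theta_split_mod_two {ι : Type*} {N : ι → ℤ} (hN : AdmissibleWeight N) (S : Set ι)
    (f : ι → ℤ) :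
    theta S N = theta {i ∈ S | f i % 2 = 0} N + theta {i ∈ S | f i % 2 = 1} N := by
  rw [← theta_union hN]
  · congr 1
    ext i
    simp only [Set.mem_union, Set.mem_ofPred_eq]
    have : f i % 2 = 0 ∨ f i % 2 = 1 := by omega
    tauto
  · rw [Set.disjoint_left]
    rintro i ⟨_, h⟩ ⟨_, h'⟩
    omega

theorem coeff_natCast_mul (m : ℕ) (f : ℚ⟦X⟧) (l : ℕ) :
    coeff l ((m : ℚ⟦X⟧) * f) = m * coeff l f := by
  rw [← nsmul_eq_mul, map_nsmul, nsmul_eq_mul]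

/-! ### Theta series of the Eisenstein integers and their residue classes. -/

/-- The norm of the Eisenstein integer `x + y ω`, where `ω` is a primitive cube root of unity. -/
def eisNorm (v : ℤ × ℤ) : ℤ := v.1 ^ 2 - v.1 * v.2 + v.2 ^ 2

theorem eisNorm_nonneg (v : ℤ × ℤ) : 0 ≤ eisNorm v := by
  unfold eisNorm
  nlinarith [sq_nonneg (v.1 - v.2), sq_nonneg v.1, sq_nonneg v.2]

theorem eisNorm_admissible : AdmissibleWeight eisNorm := by
  refine ⟨eisNorm_nonneg, fun n => ?_⟩
  refine ((Set.finite_Icc (-(2 * n) - 1) (2 * n + 1)).prod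
    (Set.finite_Icc (-(2 * n) - 1) (2 * n + 1))).subset ?_
  rintro ⟨x, y⟩ h
  simp only [Set.mem_ofPred_eq, eisNorm] at h
  have h1 : x ^ 2 ≤ 2 * n := by nlinarith [sq_nonneg (x - 2 * y), sq_nonneg x]
  have h2 : y ^ 2 ≤ 2 * n := by nlinarith [sq_nonneg (2 * x - y), sq_nonneg y]
  simp only [Set.mem_prod, Set.mem_Icc]
  refine ⟨⟨?_, ?_⟩, ?_, ?_⟩ <;> nlinarith

theorem eisNorm_mul_admissible {k : ℕ} (hk : 0 < k) :
    AdmissibleWeight fun v => (k : ℤ) * eisNorm v :=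
  eisNorm_admissible.const_mul (by exact_mod_cast hk)

/-- `∑ q ^ (k N(v))` over all Eisenstein integers `v`. -/
noncomputable def thetaA (k : ℕ) : PowerSeries ℚ :=
  theta Set.univ fun v : ℤ × ℤ => (k : ℤ) * eisNorm v

/-- `∑ q ^ (k N(v))` over the Eisenstein integers `v` congruent to `1` modulo `√-3`. -/
noncomputable def thetaC (k : ℕ) : PowerSeries ℚ :=
  theta {v : ℤ × ℤ | (v.1 + v.2) % 3 = 1} fun v => (k : ℤ) * eisNorm v

/-- `∑ q ^ (k N(v))` over the Eisenstein integers `v` congruent to `i + j ω` modulo `3`. -/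
noncomputable def classTheta (k : ℕ) (i j : ℤ) : PowerSeries ℚ :=
  theta {v : ℤ × ℤ | v.1 % 3 = i ∧ v.2 % 3 = j} fun v => (k : ℤ) * eisNorm v

/-- Since ω ≡ 1 mod √-3, the residue of x + yω is x + y mod 3. The bijection is multiplication by
√-3 = 1 + 2ω, of norm 3. -/
theorem theta_residue_zero (k : ℕ) :
    theta {v : ℤ × ℤ | (v.1 + v.2) % 3 = 0} (fun v => (k : ℤ) * eisNorm v) = thetaA (3 * k) := by
  refine (theta_congr (fun v => (v.1 - 2 * v.2, 2 * v.1 - v.2))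
    (fun v => ((2 * v.2 - v.1) / 3, (v.2 - 2 * v.1) / 3)) ?_ ?_ ?_ ?_ ?_).symm
  all_goals rintro ⟨x, y⟩ h
  all_goals simp only [Set.mem_ofPred_eq, Set.mem_univ, Prod.mk.injEq, eisNorm] at h ⊢
  · omega
  · omega
  · omega
  · push_cast
    ring

theorem theta_residue_two (k : ℕ) :
    theta {v : ℤ × ℤ | (v.1 + v.2) % 3 = 2} (fun v => (k : ℤ) * eisNorm v) = thetaC k := by
  refine theta_congr (fun v => (-v.1, -v.2)) (fun v => (-v.1, -v.2)) ?_ ?_ ?_ ?_ ?_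
  all_goals rintro ⟨x, y⟩ h
  all_goals simp only [Set.mem_ofPred_eq, Prod.mk.injEq, eisNorm] at h ⊢
  · omega
  · omega
  · omega
  · omega
  · ring

theorem thetaA_eq {k : ℕ} (hk : 0 < k) : thetaA k = thetaA (3 * k) + 2 * thetaC k := by
  conv_lhs => rw [thetaA, theta_split_mod_three (eisNorm_mul_admissible hk) _
    fun v => v.1 + v.2]
  simp only [Set.mem_univ, true_and]
  rw [theta_residue_zero, theta_residue_two, ← thetaC]
  ring

theorem classTheta_zero_zero (k : ℕ) : classTheta k 0 0 = thetaA (9 * k) := by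
  refine (theta_congr (fun v => (3 * v.1, 3 * v.2)) (fun v => (v.1 / 3, v.2 / 3))
    ?_ ?_ ?_ ?_ ?_).symm
  all_goals rintro ⟨x, y⟩ h
  all_goals simp only [Set.mem_ofPred_eq, Set.mem_univ, Prod.mk.injEq, eisNorm] at h ⊢
  · omega
  · omega
  · omega
  · push_cast
    ring

/-- Multiplication by √-3 carries the class of 1 mod √-3 onto the class of 1 + 2ω mod 3. -/
theorem classTheta_one_two (k : ℕ) : classTheta k 1 2 = thetaC (3 * k) := by
  refine (theta_congr (fun v => (v.1 - 2 * v.2, 2 * v.1 - v.2))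
    (fun v => ((2 * v.2 - v.1) / 3, (v.2 - 2 * v.1) / 3)) ?_ ?_ ?_ ?_ ?_).symm
  all_goals rintro ⟨x, y⟩ h
  all_goals simp only [Set.mem_ofPred_eq, Prod.mk.injEq, eisNorm] at h ⊢
  · omega
  · omega
  · omega
  · omega
  · push_cast
    ring

theorem classTheta_neg (k : ℕ) {i j i' j' : ℤ} (hi : (i + i') % 3 = 0) (hj : (j + j') % 3 = 0)
    (hi0 : 0 ≤ i ∧ i < 3 := by norm_num) (hj0 : 0 ≤ j ∧ j < 3 := by norm_num)
    (hi0' : 0 ≤ i' ∧ i' < 3 := by norm_num) (hj0' : 0 ≤ j' ∧ j' < 3 := by norm_num) :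
    classTheta k i j = classTheta k i' j' := by
  refine theta_congr (fun v => (-v.1, -v.2)) (fun v => (-v.1, -v.2)) ?_ ?_ ?_ ?_ ?_
  all_goals rintro ⟨x, y⟩ h
  all_goals simp only [Set.mem_ofPred_eq, Prod.mk.injEq, eisNorm] at h ⊢
  · omega
  · omega
  · omega
  · omega
  · ring

/-- Multiplication by the unit ω preserves the norm and permutes the classes mod 3. -/
theorem classTheta_rotate (k : ℕ) {i j i' j' : ℤ} (hi : (i' + j) % 3 = 0)
    (hj : (i - j - j') % 3 = 0)
    (hi0 : 0 ≤ i ∧ i < 3 := by norm_num) (hj0 : 0 ≤ j ∧ j < 3 := by norm_num)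
    (hi0' : 0 ≤ i' ∧ i' < 3 := by norm_num) (hj0' : 0 ≤ j' ∧ j' < 3 := by norm_num) :
    classTheta k i j = classTheta k i' j' := by
  refine theta_congr (fun v => (-v.2, v.1 - v.2)) (fun v => (v.2 - v.1, -v.1)) ?_ ?_ ?_ ?_ ?_
  all_goals rintro ⟨x, y⟩ h
  all_goals simp only [Set.mem_ofPred_eq, Prod.mk.injEq, eisNorm] at h ⊢
  · omega
  · omega
  · omega
  · omega
  · ring

theorem classTheta_two_one (k : ℕ) : classTheta k 2 1 = thetaC (3 * k) := by
  rw [← classTheta_one_two]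
  exact classTheta_neg k (by norm_num) (by norm_num)

theorem classTheta_zero_one (k : ℕ) : classTheta k 0 1 = classTheta k 1 0 :=
  (classTheta_rotate k (by norm_num) (by norm_num)).symm

theorem classTheta_two_two (k : ℕ) : classTheta k 2 2 = classTheta k 1 0 := by
  rw [← classTheta_zero_one]
  exact (classTheta_rotate k (by norm_num) (by norm_num)).symm

theorem classTheta_two_zero (k : ℕ) : classTheta k 2 0 = classTheta k 1 0 :=
  classTheta_neg k (by norm_num) (by norm_num)

theorem classTheta_zero_two (k : ℕ) : classTheta k 0 2 = classTheta k 1 0 := by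
  rw [← classTheta_zero_one]
  exact classTheta_neg k (by norm_num) (by norm_num)

theorem classTheta_one_one (k : ℕ) : classTheta k 1 1 = classTheta k 1 0 := by
  rw [← classTheta_two_two]
  exact classTheta_neg k (by norm_num) (by norm_num)

theorem thetaC_eq_three_mul {k : ℕ} (hk : 0 < k) : thetaC k = 3 * classTheta k 1 0 := by
  have h : ∀ i j : ℤ, 0 ≤ i ∧ i < 3 → (i + j) % 3 = 1 → 0 ≤ j ∧ j < 3 →
      theta {v ∈ {v : ℤ × ℤ | (v.1 + v.2) % 3 = 1} | v.1 % 3 = i} (fun v => (k : ℤ) * eisNorm v) =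
      classTheta k i j := by
    intro i j hi hij hj
    rw [classTheta]
    congr 1
    ext v
    simp only [Set.mem_ofPred_eq]
    omega
  rw [thetaC, theta_split_mod_three (eisNorm_mul_admissible hk) _ fun v => v.1,
    h 0 1 (by norm_num) (by norm_num) (by norm_num),
    h 1 0 (by norm_num) (by norm_num) (by norm_num),
    h 2 2 (by norm_num) (by norm_num) (by norm_num), classTheta_zero_one, classTheta_two_two]
  ring

/-! ### Product and cubic identities, passing from level k to level 3k. -/

/-- N(p + 2q) + 2N(p - q) = 3N(p) + 6N(q), and (p + 2q, p - q) runs over the pairs congruent mod 3.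
-/
theorem thetaA_mul_thetaA_eq_theta {k : ℕ} (hk : 0 < k) : thetaA (3 * k) * thetaA (6 * k) =
    theta {p : (ℤ × ℤ) × (ℤ × ℤ) | (p.1.1 - p.2.1) % 3 = 0 ∧ (p.1.2 - p.2.2) % 3 = 0}
      fun p => (k : ℤ) * eisNorm p.1 + ((2 * k : ℕ) : ℤ) * eisNorm p.2 := by
  rw [thetaA, thetaA, theta_mul (eisNorm_mul_admissible (by positivity))
    (eisNorm_mul_admissible (by positivity))]
  refine theta_congr
    (fun p => ((p.1.1 + 2 * p.2.1, p.1.2 + 2 * p.2.2), (p.1.1 - p.2.1, p.1.2 - p.2.2)))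
    (fun p => ((p.2.1 + (p.1.1 - p.2.1) / 3, p.2.2 + (p.1.2 - p.2.2) / 3),
      ((p.1.1 - p.2.1) / 3, (p.1.2 - p.2.2) / 3))) ?_ ?_ ?_ ?_ ?_
  all_goals rintro ⟨⟨x, y⟩, z, w⟩ h
  all_goals simp only [Set.mem_ofPred_eq, Set.mem_univ, Set.mem_prod, Prod.mk.injEq, eisNorm,
    true_and] at h ⊢
  · omega
  · omega
  · omega
  · push_cast
    ring

/-- Of the nine common classes mod 3, one is zero, two are the nonzero multiples of √-3, and the six
unit classes contribute equally. -/
theorem thetaA_mul_thetaA_eq {k : ℕ} (hk : 0 < k) : thetaA (3 * k) * thetaA (6 * k) =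
    thetaA (9 * k) * thetaA (18 * k) + 2 * (thetaC (3 * k) * thetaC (6 * k)) +
      6 * (classTheta k 1 0 * classTheta (2 * k) 1 0) := by
  have hk1 := eisNorm_mul_admissible hk
  have hk2 := eisNorm_mul_admissible (show 0 < 2 * k by positivity)
  have h : ∀ i j : ℤ, 0 ≤ i ∧ i < 3 → 0 ≤ j ∧ j < 3 →
      theta {p ∈ {p ∈ {p : (ℤ × ℤ) × (ℤ × ℤ) |
        (p.1.1 - p.2.1) % 3 = 0 ∧ (p.1.2 - p.2.2) % 3 = 0} | p.1.1 % 3 = i} | p.1.2 % 3 = j}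
        (fun p => (k : ℤ) * eisNorm p.1 + ((2 * k : ℕ) : ℤ) * eisNorm p.2) =
      classTheta k i j * classTheta (2 * k) i j := by
    intro i j hi hj
    rw [classTheta, classTheta, theta_mul hk1 hk2]
    congr 1
    ext p
    simp only [Set.mem_ofPred_eq, Set.mem_prod]
    omega
  have hrow : ∀ i : ℤ, 0 ≤ i ∧ i < 3 →
      theta {p ∈ {p : (ℤ × ℤ) × (ℤ × ℤ) |
        (p.1.1 - p.2.1) % 3 = 0 ∧ (p.1.2 - p.2.2) % 3 = 0} | p.1.1 % 3 = i}
        (fun p => (k : ℤ) * eisNorm p.1 + ((2 * k : ℕ) : ℤ) * eisNorm p.2) =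
      classTheta k i 0 * classTheta (2 * k) i 0 + classTheta k i 1 * classTheta (2 * k) i 1 +
        classTheta k i 2 * classTheta (2 * k) i 2 := by
    intro i hi
    rw [theta_split_mod_three (hk1.add hk2) _ fun p => p.1.2, h i 0 hi (by norm_num),
      h i 1 hi (by norm_num), h i 2 hi (by norm_num)]
  rw [thetaA_mul_thetaA_eq_theta hk, theta_split_mod_three (hk1.add hk2) _ fun p => p.1.1,
    hrow 0 (by norm_num), hrow 1 (by norm_num), hrow 2 (by norm_num)]
  rw [classTheta_zero_zero, classTheta_zero_zero, classTheta_one_two, classTheta_one_two,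
    classTheta_two_one, classTheta_two_one]
  simp only [classTheta_zero_one, classTheta_zero_two, classTheta_one_one, classTheta_two_two,
    classTheta_two_zero, ← mul_assoc]
  norm_num
  ring

/-- Expanding A(3k)A(6k) by A(j) = A(3j) + 2C(j) as well cancels A(9k)A(18k) and isolates the
product of unit classes. -/
theorem thetaC_mul_thetaC_eq {k : ℕ} (hk : 0 < k) : thetaC k * thetaC (2 * k) =
    3 * (thetaA (9 * k) * thetaC (6 * k) + thetaA (18 * k) * thetaC (3 * k) +
      thetaC (3 * k) * thetaC (6 * k)) := by
  have h := thetaA_mul_thetaA_eq hk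
  have h1 := thetaA_eq (show 0 < 3 * k by positivity)
  have h2 := thetaA_eq (show 0 < 6 * k by positivity)
  rw [← mul_assoc] at h1 h2
  norm_num at h1 h2
  rw [h1, h2] at h
  rw [thetaC_eq_three_mul hk, thetaC_eq_three_mul (show 0 < 2 * k by positivity)]
  have := charZero_powerSeries_rat
  refine mul_left_cancel₀ (two_ne_zero (α := ℚ⟦X⟧)) ?_
  linear_combination -3 * h

theorem theta_residue_prod_prod {k : ℕ} (hk : 0 < k) :
    theta {p : (ℤ × ℤ) × (ℤ × ℤ) × (ℤ × ℤ) |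
      (p.1.1 + p.1.2 + (p.2.1.1 + p.2.1.2) + (p.2.2.1 + p.2.2.2)) % 3 = 2}
      (fun p => (k : ℤ) * eisNorm p.1 + k * eisNorm p.2.1 + k * eisNorm p.2.2) =
    3 * thetaC k * (thetaA (3 * k) ^ 2 + thetaA (3 * k) * thetaC k + thetaC k ^ 2) := by
  have hk1 := eisNorm_mul_admissible hk
  have hk3 := hk1.add (hk1.add hk1)
  simp only [← add_assoc] at hk3
  have h : ∀ i j l : ℤ, 0 ≤ i ∧ i < 3 → 0 ≤ j ∧ j < 3 → 0 ≤ l ∧ l < 3 → (i + j + l) % 3 = 2 →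
      theta {p ∈ {p ∈ {p : (ℤ × ℤ) × (ℤ × ℤ) × (ℤ × ℤ) |
        (p.1.1 + p.1.2 + (p.2.1.1 + p.2.1.2) + (p.2.2.1 + p.2.2.2)) % 3 = 2} |
        (p.1.1 + p.1.2) % 3 = i} | (p.2.1.1 + p.2.1.2) % 3 = j}
        (fun p => (k : ℤ) * eisNorm p.1 + k * eisNorm p.2.1 + k * eisNorm p.2.2) =
      theta {v : ℤ × ℤ | (v.1 + v.2) % 3 = i} (fun v => (k : ℤ) * eisNorm v) *
      theta {v : ℤ × ℤ | (v.1 + v.2) % 3 = j} (fun v => (k : ℤ) * eisNorm v) *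
      theta {v : ℤ × ℤ | (v.1 + v.2) % 3 = l} (fun v => (k : ℤ) * eisNorm v) := by
    intro i j l hi hj hl hijl
    rw [theta_mul_mul hk1 hk1 hk1]
    congr 1
    ext p
    simp only [Set.mem_ofPred_eq, Set.mem_prod]
    omega
  have hrow : ∀ i : ℤ, 0 ≤ i ∧ i < 3 →
      theta {p ∈ {p : (ℤ × ℤ) × (ℤ × ℤ) × (ℤ × ℤ) |
        (p.1.1 + p.1.2 + (p.2.1.1 + p.2.1.2) + (p.2.2.1 + p.2.2.2)) % 3 = 2} |
        (p.1.1 + p.1.2) % 3 = i}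
        (fun p => (k : ℤ) * eisNorm p.1 + k * eisNorm p.2.1 + k * eisNorm p.2.2) = _ :=
    fun i hi => (theta_split_mod_three hk3 _ fun p => p.2.1.1 + p.2.1.2).trans
      (congrArg₂ _ (congrArg₂ _
        (h i 0 ((2 - i) % 3) hi (by norm_num) (by omega) (by omega))
        (h i 1 ((1 - i) % 3) hi (by norm_num) (by omega) (by omega)))
        (h i 2 ((0 - i) % 3) hi (by norm_num) (by omega) (by omega)))
  rw [theta_split_mod_three hk3 _ fun p => p.1.1 + p.1.2,
    hrow 0 (by norm_num), hrow 1 (by norm_num), hrow 2 (by norm_num)]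
  norm_num only
  rw [theta_residue_zero, theta_residue_two, ← thetaC]
  ring

/-- The bijection is the negated Fourier transform on ℤ/3: (u, v, w) goes to minus (u+v+w, u+ω²v+ωw,
u+ωv+ω²w), which triples the total norm. All three entries are ≡ -(u+v+w) mod √-3, so u+v+w ≡ 2
makes them ≡ 1. -/
theorem theta_sum_zero_eq {k : ℕ} (hk : 0 < k) :
    theta {p ∈ {v : ℤ × ℤ | (v.1 + v.2) % 3 = 1} ×ˢ {v : ℤ × ℤ | (v.1 + v.2) % 3 = 1} ×ˢ
        {v : ℤ × ℤ | (v.1 + v.2) % 3 = 1} | (p.1.1 + p.2.1.1 + p.2.2.1) % 3 = 0}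
      (fun p => (k : ℤ) * eisNorm p.1 + k * eisNorm p.2.1 + k * eisNorm p.2.2) =
    3 * thetaC (3 * k) *
      (thetaA (9 * k) ^ 2 + thetaA (9 * k) * thetaC (3 * k) + thetaC (3 * k) ^ 2) := by
  have h := theta_residue_prod_prod (show 0 < 3 * k by positivity)
  rw [← mul_assoc] at h
  norm_num only at h
  rw [← h]
  refine (theta_congr
    (fun p : (ℤ × ℤ) × (ℤ × ℤ) × (ℤ × ℤ) =>
      ((-(p.1.1 + p.2.1.1 + p.2.2.1), -(p.1.2 + p.2.1.2 + p.2.2.2)),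
       (-(p.1.1 + (p.2.1.2 - p.2.1.1) - p.2.2.2), -(p.1.2 - p.2.1.1 + (p.2.2.1 - p.2.2.2))),
       (-(p.1.1 - p.2.1.2 + (p.2.2.2 - p.2.2.1)), -(p.1.2 + (p.2.1.1 - p.2.1.2) - p.2.2.1))))
    (fun p : (ℤ × ℤ) × (ℤ × ℤ) × (ℤ × ℤ) =>
      ((-(p.1.1 + p.2.1.1 + p.2.2.1) / 3, -(p.1.2 + p.2.1.2 + p.2.2.2) / 3),
       (-(p.1.1 - p.2.1.2 + (p.2.2.2 - p.2.2.1)) / 3,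
        -(p.1.2 + (p.2.1.1 - p.2.1.2) - p.2.2.1) / 3),
       (-(p.1.1 + (p.2.1.2 - p.2.1.1) - p.2.2.2) / 3,
        -(p.1.2 - p.2.1.1 + (p.2.2.1 - p.2.2.2)) / 3))) ?_ ?_ ?_ ?_ ?_).symm
  all_goals rintro ⟨⟨a, b⟩, ⟨c, d⟩, e, f⟩ h
  all_goals simp only [Set.mem_ofPred_eq, Set.mem_prod, Prod.mk.injEq, eisNorm] at h ⊢
  · omega
  · omega
  · omega
  · omega
  · push_cast
    ring

theorem thetaC_pow_three {k : ℕ} (hk : 0 < k) :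
    thetaC k ^ 3 = 9 * thetaC (3 * k) *
      (thetaA (9 * k) ^ 2 + thetaA (9 * k) * thetaC (3 * k) + thetaC (3 * k) ^ 2) := by
  have hk1 := eisNorm_mul_admissible hk
  have hk3 := hk1.add (hk1.add hk1)
  simp only [← add_assoc] at hk3
  have hrot : ∀ i j : ℤ, 0 ≤ i ∧ i < 3 → 0 ≤ j ∧ j < 3 → (i - j) % 3 = 1 →
      theta {p ∈ {v : ℤ × ℤ | (v.1 + v.2) % 3 = 1} ×ˢ {v : ℤ × ℤ | (v.1 + v.2) % 3 = 1} ×ˢ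
          {v : ℤ × ℤ | (v.1 + v.2) % 3 = 1} | (p.1.1 + p.2.1.1 + p.2.2.1) % 3 = i}
        (fun p => (k : ℤ) * eisNorm p.1 + k * eisNorm p.2.1 + k * eisNorm p.2.2) =
      theta {p ∈ {v : ℤ × ℤ | (v.1 + v.2) % 3 = 1} ×ˢ {v : ℤ × ℤ | (v.1 + v.2) % 3 = 1} ×ˢ
          {v : ℤ × ℤ | (v.1 + v.2) % 3 = 1} | (p.1.1 + p.2.1.1 + p.2.2.1) % 3 = j}
        (fun p => (k : ℤ) * eisNorm p.1 + k * eisNorm p.2.1 + k * eisNorm p.2.2) := by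
    intro i j hi hj hij
    -- Multiplying only the first entry by ω lowers its first coordinate by 1 mod 3, since x + y ≡
    -- 1.
    refine theta_congr (fun p => ((-p.1.2, p.1.1 - p.1.2), p.2))
      (fun p => ((p.1.2 - p.1.1, -p.1.1), p.2)) ?_ ?_ ?_ ?_ ?_
    all_goals rintro ⟨⟨a, b⟩, ⟨c, d⟩, e, f⟩ h
    all_goals simp only [Set.mem_ofPred_eq, Set.mem_prod, Prod.mk.injEq, eisNorm] at h ⊢
    · omega
    · omega
    · simp
    · simp
    · ring
  have h : thetaC k ^ 3 = thetaC k * thetaC k * thetaC k := by ring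
  rw [h]
  unfold thetaC
  rw [theta_mul_mul hk1 hk1 hk1, theta_split_mod_three hk3 _ fun p => p.1.1 + p.2.1.1 + p.2.2.1,
    hrot 2 1 (by norm_num) (by norm_num) (by norm_num),
    hrot 1 0 (by norm_num) (by norm_num) (by norm_num), theta_sum_zero_eq hk, ← thetaC]
  ring

/-! ### Orders of vanishing and the descent for the quadratic relations. -/

theorem X_pow_dvd_thetaC (k : ℕ) : (X : ℚ⟦X⟧) ^ k ∣ thetaC k := by
  rw [X_pow_dvd_iff]
  intro m hm
  refine coeff_theta_eq_zero ?_
  rintro ⟨x, y⟩ h h'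
  have h0 := eisNorm_nonneg (x, y)
  rcases h0.lt_or_eq with h0 | h0
  · zify at hm
    nlinarith
  · rw [← h0] at h'
    simp only [eisNorm, Set.mem_ofPred_eq] at h h0
    have hx : x = 0 := by nlinarith [sq_nonneg (x - 2 * y), sq_nonneg x]
    have hy : y = 0 := by nlinarith [sq_nonneg (2 * x - y), sq_nonneg y]
    subst hx hy
    norm_num at h

theorem X_pow_dvd_thetaA_sub_one (k : ℕ) : (X : ℚ⟦X⟧) ^ k ∣ thetaA k - 1 := by
  rw [X_pow_dvd_iff]
  intro m hm
  have hk : (0 : ℤ) < k := by omega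
  rw [map_sub, coeff_one, sub_eq_zero]
  split_ifs with h
  · subst h
    rw [thetaA, coeff_theta, Nat.cast_eq_one, Set.ncard_eq_one]
    refine ⟨(0, 0), ?_⟩
    ext ⟨x, y⟩
    simp only [Set.mem_univ, true_and, Set.mem_ofPred_eq, Set.mem_singleton_iff, Prod.mk.injEq,
      Nat.cast_zero, mul_eq_zero, hk.ne', false_or, eisNorm]
    constructor
    · intro h
      constructor
      · nlinarith [sq_nonneg (x - 2 * y), sq_nonneg x]
      · nlinarith [sq_nonneg (2 * x - y), sq_nonneg y]
    · rintro ⟨rfl, rfl⟩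
      norm_num
  · refine coeff_theta_eq_zero ?_
    intro v _ h'
    have h0 := eisNorm_nonneg v
    rcases h0.lt_or_eq with h0 | h0
    · zify at hm
      nlinarith
    · rw [← h0, mul_zero] at h'
      exact h (by exact_mod_cast h'.symm)

/-- The element 1 has norm 1, so C(j) is X^j times a unit and can be divided out at a cost of
exactly j. -/
theorem X_pow_dvd_of_thetaC_mul {j b : ℕ} (hj : 0 < j) {f : ℚ⟦X⟧}
    (h : X ^ (j + b) ∣ thetaC j * f) : X ^ b ∣ f := by
  obtain ⟨u, hu⟩ := X_pow_dvd_thetaC j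
  have hcoeff : coeff j (thetaC j) ≠ 0 := by
    rw [thetaC, coeff_theta, Nat.cast_ne_zero]
    refine Set.ncard_ne_zero_of_mem (a := ((1, 0) : ℤ × ℤ)) ⟨by simp, by simp [eisNorm]⟩
      ((eisNorm_mul_admissible hj).finite _ _)
  have hunit : IsUnit u := by
    rw [isUnit_iff_constantCoeff, isUnit_iff_ne_zero]
    rw [hu] at hcoeff
    simpa [coeff_X_pow_mul'] using hcoeff
  rw [hu, pow_add, mul_assoc] at h
  have := (mul_dvd_mul_iff_left (pow_ne_zero j X_ne_zero)).1 h
  exact hunit.dvd_mul_left.1 this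

theorem X_pow_dvd_thetaA_sub_thetaA {j k : ℕ} (h : j ≤ k) :
    (X : ℚ⟦X⟧) ^ j ∣ thetaA j - thetaA k := by
  have := dvd_sub (X_pow_dvd_thetaA_sub_one j)
    ((pow_dvd_pow X h).trans (X_pow_dvd_thetaA_sub_one k))
  simpa using this

/-- A quadratic expression in theta functions which vanishes, see `quadF_eq_zero`. -/
noncomputable def quadF (k : ℕ) : ℚ⟦X⟧ :=
  2 * thetaC (2 * k) ^ 2 - (thetaA (3 * k) - thetaA (6 * k)) * thetaC k

/-- A quadratic expression in theta functions which vanishes, see `quadG_eq_zero`. -/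
noncomputable def quadG (k : ℕ) : ℚ⟦X⟧ :=
  thetaC k ^ 2 - thetaC (2 * k) * (thetaA (3 * k) + 2 * thetaA (6 * k))

theorem thetaA_three_mul {k : ℕ} (hk : 0 < k) : thetaA (3 * k) = thetaA (9 * k) + 2 * thetaC (3 * k) := by
  rw [thetaA_eq (show 0 < 3 * k by positivity), ← mul_assoc]
  norm_num only

theorem thetaA_six_mul {k : ℕ} (hk : 0 < k) : thetaA (6 * k) = thetaA (18 * k) + 2 * thetaC (6 * k) := by
  rw [thetaA_eq (show 0 < 6 * k by positivity), ← mul_assoc]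
  norm_num only

theorem thetaC_two_mul_pow_three {k : ℕ} (hk : 0 < k) : thetaC (2 * k) ^ 3 = 9 * thetaC (6 * k) *
    (thetaA (18 * k) ^ 2 + thetaA (18 * k) * thetaC (6 * k) + thetaC (6 * k) ^ 2) := by
  rw [thetaC_pow_three (show 0 < 2 * k by positivity), ← mul_assoc, ← mul_assoc]
  norm_num only

theorem quadF_descent {k : ℕ} (hk : 0 < k) : thetaC (2 * k) * quadF k =
    (3 * thetaA (18 * k) + 3 * thetaC (3 * k) + 9 * thetaC (6 * k)) * quadF (3 * k) +
    (3 * thetaA (9 * k) - 9 * thetaA (18 * k) - 6 * thetaC (6 * k)) * quadG (3 * k) := by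
  simp only [quadF, quadG, ← mul_assoc]
  norm_num only
  rw [thetaA_three_mul hk, thetaA_six_mul hk]
  linear_combination 2 * thetaC_two_mul_pow_three hk -
    (thetaA (9 * k) + 2 * thetaC (3 * k) - (thetaA (18 * k) + 2 * thetaC (6 * k))) *
      thetaC_mul_thetaC_eq hk

theorem quadG_descent {k : ℕ} (hk : 0 < k) : thetaC k * quadG k =
    (-9 * thetaA (9 * k) - 6 * thetaA (18 * k) - 6 * thetaC (3 * k)) * quadF (3 * k) +
    (3 * thetaA (9 * k) + 9 * thetaC (3 * k) - 6 * thetaC (6 * k)) * quadG (3 * k) := by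
  simp only [quadF, quadG, ← mul_assoc]
  norm_num only
  rw [thetaA_three_mul hk, thetaA_six_mul hk]
  linear_combination thetaC_pow_three hk -
    (thetaA (9 * k) + 2 * thetaC (3 * k) + 2 * (thetaA (18 * k) + 2 * thetaC (6 * k))) *
      thetaC_mul_thetaC_eq hk

/-- Order (m+2)·3k at level 3k, minus at most 2k for dividing by C(2k) or C(k), still exceeds
(m+3)k. -/
theorem X_pow_dvd_quad (m : ℕ) : ∀ k : ℕ, 0 < k →
    (X : ℚ⟦X⟧) ^ ((m + 2) * k) ∣ quadF k ∧ (X : ℚ⟦X⟧) ^ ((m + 2) * k) ∣ quadG k := by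
  induction m with
  | zero =>
    intro k hk
    have hC := X_pow_dvd_thetaC k
    have hC2 := X_pow_dvd_thetaC (2 * k)
    have hA := (pow_dvd_pow X (show k ≤ 3 * k by omega)).trans
      (X_pow_dvd_thetaA_sub_thetaA (show 3 * k ≤ 6 * k by omega))
    have hsq : (X : ℚ⟦X⟧) ^ ((0 + 2) * k) = X ^ k * X ^ k := by ring
    constructor
    · refine dvd_sub (Dvd.dvd.mul_left ?_ _) ?_
      · rw [zero_add, sq]
        exact hC2.mul_right _
      · rw [hsq]
        exact mul_dvd_mul hA hC
    · refine dvd_sub ?_ ?_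
      · rw [hsq, sq]
        exact mul_dvd_mul hC hC
      · rw [zero_add]
        exact hC2.mul_right _
  | succ m ih =>
    intro k hk
    obtain ⟨hF, hG⟩ := ih (3 * k) (by positivity)
    have h1 : (X : ℚ⟦X⟧) ^ (2 * k + (m + 1 + 2) * k) ∣ X ^ ((m + 2) * (3 * k)) :=
      pow_dvd_pow X (by nlinarith)
    have h2 : (X : ℚ⟦X⟧) ^ (k + (m + 1 + 2) * k) ∣ X ^ ((m + 2) * (3 * k)) :=
      pow_dvd_pow X (by nlinarith)
    constructor
    · refine X_pow_dvd_of_thetaC_mul (show 0 < 2 * k by positivity) ?_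
      rw [quadF_descent hk]
      exact h1.trans (dvd_add (hF.mul_left _) (hG.mul_left _))
    · refine X_pow_dvd_of_thetaC_mul hk ?_
      rw [quadG_descent hk]
      exact h2.trans (dvd_add (hF.mul_left _) (hG.mul_left _))

theorem eq_zero_of_forall_X_pow_dvd {f : ℚ⟦X⟧} {k : ℕ} (hk : 0 < k)
    (h : ∀ m : ℕ, X ^ ((m + 2) * k) ∣ f) : f = 0 := by
  ext n
  exact X_pow_dvd_iff.1 (h n) n (by nlinarith)

theorem quadF_eq_zero {k : ℕ} (hk : 0 < k) : quadF k = 0 :=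
  eq_zero_of_forall_X_pow_dvd hk fun m => (X_pow_dvd_quad m k hk).1

theorem quadG_eq_zero {k : ℕ} (hk : 0 < k) : quadG k = 0 :=
  eq_zero_of_forall_X_pow_dvd hk fun m => (X_pow_dvd_quad m k hk).2

theorem thetaC_mul_form_eq {k : ℕ} (hk : 0 < k) :
    thetaC k * (thetaA (3 * k) * thetaA (6 * k) + 2 * thetaC k * thetaC (2 * k)) =
      thetaA (3 * k) ^ 2 * thetaC k + 4 * thetaA (6 * k) * thetaC (2 * k) ^ 2 := by
  have hF := quadF_eq_zero hk
  have hG := quadG_eq_zero hk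
  rw [quadF] at hF
  rw [quadG] at hG
  linear_combination (thetaA (3 * k)) * hF + 2 * thetaC (2 * k) * hG

/-! ### Coefficient extraction by congruences on exponents. -/

theorem eisNorm_emod_three_of_one {v : ℤ × ℤ} (h : (v.1 + v.2) % 3 = 1) : eisNorm v % 3 = 1 := by
  obtain ⟨x, y⟩ := v
  have hx : x = 1 - y + 3 * ((x + y) / 3) := by
    simp only at h
    omega
  generalize (x + y) / 3 = t at hx
  subst hx
  have : eisNorm (1 - y + 3 * t, y) = 1 + 3 * (y ^ 2 - y - 3 * t * y + 3 * t ^ 2 + 2 * t) := by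
    simp only [eisNorm]
    ring
  omega

theorem coeff_thetaA_sq_mul_thetaA (n : ℕ) :
    coeff (6 * n + 1) (thetaA 1 ^ 2 * thetaA 2) =
      4 * coeff (6 * n + 1) (thetaA 3 ^ 2 * thetaC 1) := by
  have a3 := eisNorm_mul_admissible (show 0 < 3 by norm_num)
  have a6 := eisNorm_mul_admissible (show 0 < 6 by norm_num)
  have a1 := eisNorm_mul_admissible (show 0 < 1 by norm_num)
  have a2 := eisNorm_mul_admissible (show 0 < 2 by norm_num)
  have h1 := thetaA_eq (show 0 < 1 by norm_num)
  have h2 := thetaA_eq (show 0 < 2 by norm_num)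
  have h3 := thetaC_mul_form_eq (show 0 < 1 by norm_num)
  norm_num only at h1 h2 h3
  have key : thetaA 1 ^ 2 * thetaA 2 = (4 : ℕ) * (thetaA 3 ^ 2 * thetaC 1) +
      ((16 : ℕ) * (thetaC 2 * thetaC 2 * thetaA 6) + thetaA 3 * thetaA 3 * thetaA 6 +
        (2 : ℕ) * (thetaA 3 * thetaA 3 * thetaC 2) +
        (4 : ℕ) * (thetaC 1 * thetaC 1 * thetaA 6) +
        (8 : ℕ) * (thetaC 1 * thetaA 3 * thetaC 2)) := by
    rw [h1, h2]
    push_cast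
    linear_combination 4 * h3
  -- This term dies by parity; the four below die modulo 3.
  have z1 : coeff (6 * n + 1) (thetaC 2 * thetaC 2 * thetaA 6) = 0 := by
    refine coeff_theta_mul_mul_eq_zero a2 a2 a6 fun i _ j _ k _ => ?_
    push_cast
    omega
  have z2 : coeff (6 * n + 1) (thetaA 3 * thetaA 3 * thetaA 6) = 0 := by
    refine coeff_theta_mul_mul_eq_zero a3 a3 a6 fun i _ j _ k _ => ?_
    push_cast
    omega
  have z3 : coeff (6 * n + 1) (thetaA 3 * thetaA 3 * thetaC 2) = 0 := by
    refine coeff_theta_mul_mul_eq_zero a3 a3 a2 fun i _ j _ k hk => ?_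
    have := eisNorm_emod_three_of_one hk
    push_cast
    omega
  have z4 : coeff (6 * n + 1) (thetaC 1 * thetaC 1 * thetaA 6) = 0 := by
    refine coeff_theta_mul_mul_eq_zero a1 a1 a6 fun i hi j hj k _ => ?_
    have := eisNorm_emod_three_of_one hi
    have := eisNorm_emod_three_of_one hj
    push_cast
    omega
  have z5 : coeff (6 * n + 1) (thetaC 1 * thetaA 3 * thetaC 2) = 0 := by
    refine coeff_theta_mul_mul_eq_zero a1 a3 a2 fun i hi j _ k hk => ?_
    have := eisNorm_emod_three_of_one hi
    have := eisNorm_emod_three_of_one hk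
    push_cast
    omega
  rw [key]
  simp only [map_add, coeff_natCast_mul, z1, z2, z3, z4, z5]
  push_cast
  ring

/-- Exponents of C(3) are 3 mod 9 and those of A(9) are 0 mod 9, so only A(9)²C(3) reaches 18n+3. -/
theorem coeff_thetaC_pow_three (n : ℕ) :
    coeff (18 * n + 3) (thetaC 1 ^ 3) = 9 * coeff (6 * n + 1) (thetaA 3 ^ 2 * thetaC 1) := by
  have a9 := eisNorm_mul_admissible (show 0 < 9 by norm_num)
  have a3 := eisNorm_mul_admissible (show 0 < 3 by norm_num)
  have a1 := eisNorm_mul_admissible (show 0 < 1 by norm_num)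
  have h := thetaC_pow_three (show 0 < 1 by norm_num)
  norm_num only at h
  have key : thetaC 1 ^ 3 = (9 : ℕ) * (thetaA 9 * thetaA 9 * thetaC 3) +
      ((9 : ℕ) * (thetaA 9 * thetaC 3 * thetaC 3) +
        (9 : ℕ) * (thetaC 3 * thetaC 3 * thetaC 3)) := by
    rw [h]
    push_cast
    ring
  have z1 : coeff (18 * n + 3) (thetaA 9 * thetaC 3 * thetaC 3) = 0 := by
    refine coeff_theta_mul_mul_eq_zero a9 a3 a3 fun i _ j hj k hk => ?_
    have := eisNorm_emod_three_of_one hj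
    have := eisNorm_emod_three_of_one hk
    push_cast
    omega
  have z2 : coeff (18 * n + 3) (thetaC 3 * thetaC 3 * thetaC 3) = 0 := by
    refine coeff_theta_mul_mul_eq_zero a3 a3 a3 fun i hi j hj k hk => ?_
    have := eisNorm_emod_three_of_one hi
    have := eisNorm_emod_three_of_one hj
    have := eisNorm_emod_three_of_one hk
    push_cast
    omega
  have z3 : coeff (18 * n + 3) (thetaA 9 * thetaA 9 * thetaC 3) =
      coeff (6 * n + 1) (thetaA 3 ^ 2 * thetaC 1) := by
    rw [sq, show 18 * n + 3 = 3 * (6 * n + 1) by ring]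
    unfold thetaA thetaC
    rw [theta_mul_mul a3 a3 a1, theta_mul_mul a9 a9 a3,
      ← coeff_theta_const_mul _
        (fun p : (ℤ × ℤ) × (ℤ × ℤ) × (ℤ × ℤ) => ((3 : ℕ) : ℤ) * eisNorm p.1 +
          ((3 : ℕ) : ℤ) * eisNorm p.2.1 + ((1 : ℕ) : ℤ) * eisNorm p.2.2)
        (show 0 < 3 by norm_num)]
    refine congrArg (coeff _) (congrArg (theta _) (funext fun p => ?_))
    push_cast
    ring
  rw [key]
  simp only [map_add, coeff_natCast_mul, z1, z2, z3]
  push_cast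
  ring

/-! ### The form x² + 3y² and congruences modulo 2. -/

/-- `∑ q ^ (x² + 3 y²)` over the pairs of integers with `x + y` odd. -/
noncomputable def thetaOdd : ℚ⟦X⟧ :=
  theta {v : ℤ × ℤ | (v.1 + v.2) % 2 = 1} fun v => v.1 ^ 2 + 3 * v.2 ^ 2

theorem sq_add_three_mul_sq_admissible :
    AdmissibleWeight fun v : ℤ × ℤ => v.1 ^ 2 + 3 * v.2 ^ 2 := by
  refine ⟨fun v => by positivity, fun n => ?_⟩
  -- x² + 3y² is the norm of x + y√-3 = (x + y) + 2yω.
  refine (eisNorm_admissible.2 n).preimage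
    (f := fun v : ℤ × ℤ => (v.1 + v.2, 2 * v.2)) ?_ |>.subset ?_
  · rintro ⟨a, b⟩ _ ⟨c, d⟩ _ h
    simp only [Prod.mk.injEq] at h ⊢
    omega
  · rintro ⟨a, b⟩ h
    simp only [Set.mem_ofPred_eq, Set.mem_preimage, eisNorm] at h ⊢
    linear_combination h

theorem theta_sq_add_three_mul_sq :
    theta Set.univ (fun v : ℤ × ℤ => v.1 ^ 2 + 3 * v.2 ^ 2) = thetaA 4 + thetaOdd := by
  have h : (Set.univ : Set (ℤ × ℤ)) =
      {v : ℤ × ℤ | (v.1 + v.2) % 2 = 0} ∪ {v : ℤ × ℤ | (v.1 + v.2) % 2 = 1} := by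
    ext v
    simp only [Set.mem_univ, Set.mem_union, Set.mem_ofPred_eq, true_iff]
    omega
  rw [h, theta_union sq_add_three_mul_sq_admissible, ← thetaOdd]
  · congr 1
    refine (theta_congr (fun v => (2 * v.1 - v.2, v.2))
      (fun v => ((v.1 + v.2) / 2, v.2)) ?_ ?_ ?_ ?_ ?_).symm
    all_goals rintro ⟨x, y⟩ h
    all_goals simp only [Set.mem_ofPred_eq, Set.mem_univ, Prod.mk.injEq, eisNorm,
      and_true] at h ⊢
    · omega
    · omega
    · omega
    · push_cast
      ring
  · rw [Set.disjoint_left]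
    intro v h h'
    simp only [Set.mem_ofPred_eq] at h h'
    omega

/-- 2N(u) + 2N(w) = N(u+w) + N(u-w). If u - w ≡ 1 mod 2, both u ± w lie in ℤ[√-3] and have the form
x + y√-3 with x + y odd. Multiplication by ω permutes the three nonzero classes mod 2. -/
theorem theta_difference_class {i j : ℤ} (hi : 0 ≤ i ∧ i < 2) (hj : 0 ≤ j ∧ j < 2)
    (h : 0 < i + j) :
    theta {p : (ℤ × ℤ) × (ℤ × ℤ) | (p.1.1 - p.2.1) % 2 = i ∧ (p.1.2 - p.2.2) % 2 = j}
      (fun p => ((2 : ℕ) : ℤ) * eisNorm p.1 + ((2 : ℕ) : ℤ) * eisNorm p.2) = thetaOdd ^ 2 := by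
  have base : theta {p : (ℤ × ℤ) × (ℤ × ℤ) | (p.1.1 - p.2.1) % 2 = 1 ∧ (p.1.2 - p.2.2) % 2 = 0}
      (fun p => ((2 : ℕ) : ℤ) * eisNorm p.1 + ((2 : ℕ) : ℤ) * eisNorm p.2) = thetaOdd ^ 2 := by
    rw [sq, thetaOdd, theta_mul sq_add_three_mul_sq_admissible sq_add_three_mul_sq_admissible]
    refine theta_congr
      (fun p => ((p.1.1 + p.2.1 - (p.1.2 + p.2.2) / 2, (p.1.2 + p.2.2) / 2),
        (p.1.1 - p.2.1 - (p.1.2 - p.2.2) / 2, (p.1.2 - p.2.2) / 2)))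
      (fun p => (((p.1.1 + p.1.2 + (p.2.1 + p.2.2)) / 2, p.1.2 + p.2.2),
        ((p.1.1 + p.1.2 - (p.2.1 + p.2.2)) / 2, p.1.2 - p.2.2))) ?_ ?_ ?_ ?_ ?_
    all_goals rintro ⟨⟨x, y⟩, z, w⟩ h
    all_goals simp only [Set.mem_ofPred_eq, Set.mem_prod, Prod.mk.injEq, eisNorm] at h ⊢
    · omega
    · omega
    · omega
    · omega
    · have hy : y = w + 2 * ((y - w) / 2) := by omega
      have hw : (y + w) / 2 = w + (y - w) / 2 := by omega
      rw [hw]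
      generalize (y - w) / 2 = t at hy
      subst hy
      push_cast
      ring
  have hrot : ∀ i j i' j' : ℤ, 0 ≤ i ∧ i < 2 → 0 ≤ j ∧ j < 2 → 0 ≤ i' ∧ i' < 2 →
      0 ≤ j' ∧ j' < 2 → (j + i') % 2 = 0 → (i + j + j') % 2 = 0 →
      theta {p : (ℤ × ℤ) × (ℤ × ℤ) | (p.1.1 - p.2.1) % 2 = i ∧ (p.1.2 - p.2.2) % 2 = j}
        (fun p => ((2 : ℕ) : ℤ) * eisNorm p.1 + ((2 : ℕ) : ℤ) * eisNorm p.2) =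
      theta {p : (ℤ × ℤ) × (ℤ × ℤ) | (p.1.1 - p.2.1) % 2 = i' ∧ (p.1.2 - p.2.2) % 2 = j'}
        (fun p => ((2 : ℕ) : ℤ) * eisNorm p.1 + ((2 : ℕ) : ℤ) * eisNorm p.2) := by
    intro i j i' j' hi hj hi' hj' h1 h2
    refine theta_congr (fun p => ((-p.1.2, p.1.1 - p.1.2), (-p.2.2, p.2.1 - p.2.2)))
      (fun p => ((p.1.2 - p.1.1, -p.1.1), (p.2.2 - p.2.1, -p.2.1))) ?_ ?_ ?_ ?_ ?_
    all_goals rintro ⟨⟨x, y⟩, z, w⟩ h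
    all_goals simp only [Set.mem_ofPred_eq, Prod.mk.injEq, eisNorm] at h ⊢
    · omega
    · omega
    · omega
    · omega
    · ring
  have hcases : (i = 1 ∧ j = 0) ∨ (i = 0 ∧ j = 1) ∨ (i = 1 ∧ j = 1) := by omega
  rcases hcases with ⟨rfl, rfl⟩ | ⟨rfl, rfl⟩ | ⟨rfl, rfl⟩
  · exact base
  · rw [← base]
    exact (hrot _ _ _ _ (by norm_num) (by norm_num) (by norm_num) (by norm_num) (by norm_num)
      (by norm_num)).symm
  · rw [← base]
    exact hrot _ _ _ _ (by norm_num) (by norm_num) (by norm_num) (by norm_num) (by norm_num)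
      (by norm_num)

theorem theta_difference_zero :
    theta {p : (ℤ × ℤ) × (ℤ × ℤ) | (p.1.1 - p.2.1) % 2 = 0 ∧ (p.1.2 - p.2.2) % 2 = 0}
      (fun p => ((2 : ℕ) : ℤ) * eisNorm p.1 + ((2 : ℕ) : ℤ) * eisNorm p.2) = thetaA 4 ^ 2 := by
  have a4 := eisNorm_mul_admissible (show 0 < 4 by norm_num)
  rw [sq, thetaA, theta_mul a4 a4]
  refine (theta_congr
    (fun p => ((p.1.1 + p.2.1, p.1.2 + p.2.2), (p.1.1 - p.2.1, p.1.2 - p.2.2)))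
    (fun p => (((p.1.1 + p.2.1) / 2, (p.1.2 + p.2.2) / 2),
      ((p.1.1 - p.2.1) / 2, (p.1.2 - p.2.2) / 2))) ?_ ?_ ?_ ?_ ?_).symm
  all_goals rintro ⟨⟨x, y⟩, z, w⟩ h
  all_goals simp only [Set.mem_ofPred_eq, Set.mem_prod, Set.mem_univ, and_true, Prod.mk.injEq,
    eisNorm] at h ⊢
  · omega
  · omega
  · omega
  · push_cast
    ring

theorem thetaA_two_sq : thetaA 2 ^ 2 = thetaA 4 ^ 2 + 3 * thetaOdd ^ 2 := by
  have a2 := eisNorm_mul_admissible (show 0 < 2 by norm_num)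
  have h : ∀ i j : ℤ, theta {p ∈ {p ∈ (Set.univ : Set (ℤ × ℤ)) ×ˢ (Set.univ : Set (ℤ × ℤ)) |
        (p.1.1 - p.2.1) % 2 = i} | (p.1.2 - p.2.2) % 2 = j}
        (fun p => ((2 : ℕ) : ℤ) * eisNorm p.1 + ((2 : ℕ) : ℤ) * eisNorm p.2) =
      theta {p : (ℤ × ℤ) × (ℤ × ℤ) | (p.1.1 - p.2.1) % 2 = i ∧ (p.1.2 - p.2.2) % 2 = j}
        (fun p => ((2 : ℕ) : ℤ) * eisNorm p.1 + ((2 : ℕ) : ℤ) * eisNorm p.2) := by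
    intro i j
    congr 1
    ext p
    simp
  have hrow : ∀ i : ℤ, theta {p ∈ (Set.univ : Set (ℤ × ℤ)) ×ˢ (Set.univ : Set (ℤ × ℤ)) |
        (p.1.1 - p.2.1) % 2 = i}
        (fun p => ((2 : ℕ) : ℤ) * eisNorm p.1 + ((2 : ℕ) : ℤ) * eisNorm p.2) = _ := fun i =>
    (theta_split_mod_two (a2.add a2) _ fun p => p.1.2 - p.2.2).trans
      (congrArg₂ _ (h i 0) (h i 1))
  rw [sq, thetaA, theta_mul a2 a2, theta_split_mod_two (a2.add a2) _ fun p => p.1.1 - p.2.1,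
    hrow 0, hrow 1, theta_difference_zero,
    theta_difference_class (by norm_num) (by norm_num) (by norm_num),
    theta_difference_class (by norm_num) (by norm_num) (by norm_num),
    theta_difference_class (by norm_num) (by norm_num) (by norm_num)]
  ring

theorem formRepresentationCount_eq_coeff (n : ℕ) : (formRepresentationCount n : ℚ) =
    coeff n (theta Set.univ (fun v : ℤ × ℤ => v.1 ^ 2 + 3 * v.2 ^ 2) ^ 3) := by
  have h := sq_add_three_mul_sq_admissible
  rw [pow_three', theta_mul_mul h h h, coeff_theta, formRepresentationCount, Nat.cast_inj]
  refine Set.ncard_congr (fun v _ => ((v.1 0, v.2 0), (v.1 1, v.2 1), (v.1 2, v.2 2))) ?_ ?_ ?_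
  · intro v hv
    simp only [formRepresentations, Set.mem_ofPred_eq] at hv
    refine ⟨by simp, ?_⟩
    linear_combination hv
  · intro v w _ _ hvw
    simp only [Prod.mk.injEq] at hvw
    ext i <;> fin_cases i <;> simp [hvw]
  · rintro ⟨⟨a, b⟩, ⟨c, d⟩, e, f⟩ ⟨_, hv⟩
    refine ⟨(![a, c, e], ![b, d, f]), ?_, by simp⟩
    simp only [formRepresentations, Set.mem_ofPred_eq] at hv ⊢
    simp only [Matrix.cons_val]
    linear_combination hv

theorem sq_add_three_mul_sq_emod_two {v : ℤ × ℤ} (h : (v.1 + v.2) % 2 = 1) :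
    (v.1 ^ 2 + 3 * v.2 ^ 2) % 2 = 1 := by
  obtain ⟨x, y⟩ := v
  have hx : x = 1 - y + 2 * ((x + y) / 2) := by
    simp only at h
    omega
  generalize (x + y) / 2 = t at hx
  subst hx
  have : (1 - y + 2 * t) ^ 2 + 3 * y ^ 2 =
      1 + 2 * (2 * y ^ 2 - y - 2 * t * y + 2 * t ^ 2 + 2 * t) := by
    ring
  simp only [this]
  omega

theorem formRepresentationCount_eq (n : ℕ) : (formRepresentationCount (12 * n + 2) : ℚ) =
    coeff (6 * n + 1) (thetaA 1 ^ 2 * thetaA 2) := by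
  have a4 := eisNorm_mul_admissible (show 0 < 4 by norm_num)
  have a2 := eisNorm_mul_admissible (show 0 < 2 by norm_num)
  have a1 := eisNorm_mul_admissible (show 0 < 1 by norm_num)
  have ad := sq_add_three_mul_sq_admissible
  have key : (thetaA 4 + thetaOdd) ^ 3 =
      thetaA 2 * thetaA 2 * thetaA 4 +
        ((3 : ℕ) * (thetaA 4 * thetaA 4 * thetaOdd) + thetaOdd * thetaOdd * thetaOdd) := by
    push_cast
    linear_combination -thetaA 4 * thetaA_two_sq
  have z1 : coeff (12 * n + 2) (thetaA 4 * thetaA 4 * thetaOdd) = 0 := by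
    refine coeff_theta_mul_mul_eq_zero a4 a4 ad fun i _ j _ k hk => ?_
    have := sq_add_three_mul_sq_emod_two hk
    push_cast
    omega
  have z2 : coeff (12 * n + 2) (thetaOdd * thetaOdd * thetaOdd) = 0 := by
    refine coeff_theta_mul_mul_eq_zero ad ad ad fun i hi j hj k hk => ?_
    have := sq_add_three_mul_sq_emod_two hi
    have := sq_add_three_mul_sq_emod_two hj
    have := sq_add_three_mul_sq_emod_two hk
    push_cast
    omega
  have z3 : coeff (12 * n + 2) (thetaA 2 * thetaA 2 * thetaA 4) =
      coeff (6 * n + 1) (thetaA 1 ^ 2 * thetaA 2) := by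
    rw [sq, show 12 * n + 2 = 2 * (6 * n + 1) by ring]
    unfold thetaA
    rw [theta_mul_mul a1 a1 a2, theta_mul_mul a2 a2 a4,
      ← coeff_theta_const_mul _
        (fun p : (ℤ × ℤ) × (ℤ × ℤ) × (ℤ × ℤ) => ((1 : ℕ) : ℤ) * eisNorm p.1 +
          ((1 : ℕ) : ℤ) * eisNorm p.2.1 + ((2 : ℕ) : ℤ) * eisNorm p.2.2)
        (show 0 < 2 by norm_num)]
    refine congrArg (coeff _) (congrArg (theta _) (funext fun p => ?_))
    push_cast
    ring
  have := congrArg (coeff (12 * n + 2)) key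
  simp only [map_add, coeff_natCast_mul, z1, z2, z3] at this
  rw [formRepresentationCount_eq_coeff, theta_sq_add_three_mul_sq]
  linear_combination this

/-! ### Hook numbers and sets of first-column hook lengths. -/

namespace YoungDiagram

variable (μ : YoungDiagram)

/-- The first-column hook lengths of a Young diagram. -/
def beta (i : ℕ) : ℕ := μ.rowLen i + (μ.colLen 0 - 1 - i)

/-- The set of first-column hook lengths of a Young diagram. -/
def betaSet : Finset ℕ := (Finset.range (μ.colLen 0)).image μ.beta

/-- The increasing enumeration of the complement of the set of first-column hook lengths. -/
def gap (j : ℕ) : ℕ := j + μ.colLen 0 - μ.colLen j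

theorem lt_rowLen_iff_lt_colLen {i j : ℕ} : j < μ.rowLen i ↔ i < μ.colLen j := by
  rw [← mem_iff_lt_rowLen, mem_iff_lt_colLen]

theorem gap_lt_beta_iff {i j : ℕ} (hi : i < μ.colLen 0) : μ.gap j < μ.beta i ↔ (i, j) ∈ μ := by
  have h := μ.lt_rowLen_iff_lt_colLen (i := i) (j := j)
  have h0 := μ.colLen_anti 0 j (Nat.zero_le j)
  rw [mem_iff_lt_rowLen, gap, beta]
  omega

theorem gap_ne_beta {i j : ℕ} (hi : i < μ.colLen 0) : μ.gap j ≠ μ.beta i := by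
  have h := μ.lt_rowLen_iff_lt_colLen (i := i) (j := j)
  have h0 := μ.colLen_anti 0 j (Nat.zero_le j)
  rw [gap, beta]
  omega

theorem mem_betaSet {m : ℕ} : m ∈ μ.betaSet ↔ ∃ i < μ.colLen 0, μ.beta i = m := by
  simp [betaSet]

theorem gap_notMem_betaSet (j : ℕ) : μ.gap j ∉ μ.betaSet := by
  rw [mem_betaSet]
  rintro ⟨i, hi, h⟩
  exact μ.gap_ne_beta hi h.symm

theorem exists_gap_eq {m : ℕ} (hm : m ∉ μ.betaSet) : ∃ j, μ.gap j = m := by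
  have hex : ∃ k, μ.colLen 0 ≤ k ∨ μ.beta k ≤ m := ⟨_, Or.inl le_rfl⟩
  classical
  obtain ⟨k, hk, hmin⟩ : ∃ k, (μ.colLen 0 ≤ k ∨ μ.beta k ≤ m) ∧
      ∀ l < k, ¬(μ.colLen 0 ≤ l ∨ μ.beta l ≤ m) :=
    ⟨Nat.find hex, Nat.find_spec hex, fun l => Nat.find_min hex⟩
  have hkr : k ≤ μ.colLen 0 := by
    by_contra hlt
    exact hmin _ (not_le.1 hlt) (Or.inl le_rfl)
  have hne : k < μ.colLen 0 → μ.beta k ≠ m := fun hlt h => hm (μ.mem_betaSet.2 ⟨k, hlt, h⟩)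
  -- Exactly k of the `colLen 0` values of `beta` exceed m, so m + k - `colLen 0` non-values lie
  -- below m.
  refine ⟨m + k - μ.colLen 0, ?_⟩
  have h1 := μ.lt_rowLen_iff_lt_colLen (i := k) (j := m + k - μ.colLen 0)
  have h2 := μ.lt_rowLen_iff_lt_colLen (i := k - 1) (j := m + k - μ.colLen 0)
  have h3 := hmin (k - 1)
  have h0 := μ.colLen_anti 0 (m + k - μ.colLen 0) (Nat.zero_le _)
  simp only [beta, gap] at *
  omega

theorem hookNumber_eq {i j : ℕ} (h : (i, j) ∈ μ) :
    hookNumber μ (i, j) + μ.gap j = μ.beta i := by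
  have h1 := mem_iff_lt_rowLen.1 h
  have h2 := mem_iff_lt_colLen.1 h
  have h0 := μ.colLen_anti 0 j (Nat.zero_le j)
  simp only [hookNumber, beta, gap]
  omega

/-- Hook numbers are the differences `beta i` - `gap j` that are positive. A difference divisible by
t would let steps of -t lead from the set to its complement. -/
theorem isTCore_iff {t : ℕ} (ht : 0 < t) :
    IsTCore t μ ↔ ∀ s, s + t ∈ μ.betaSet → s ∈ μ.betaSet := by
  constructor
  · intro hcore s hs
    by_contra hns
    obtain ⟨j, hj⟩ := μ.exists_gap_eq hns
    obtain ⟨i, hi, his⟩ := μ.mem_betaSet.1 hs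
    have hmem : (i, j) ∈ μ := (μ.gap_lt_beta_iff hi).1 (by omega)
    refine hcore (i, j) hmem ?_
    have := μ.hookNumber_eq hmem
    rw [show hookNumber μ (i, j) = t by omega]
  · rintro hclosed ⟨i, j⟩ hmem ⟨d, hd⟩
    have hiter : ∀ d s, s + t * d ∈ μ.betaSet → s ∈ μ.betaSet := by
      intro d
      induction d with
      | zero => exact fun s hs => by simpa using hs
      | succ d ih =>
        intro s hs
        exact ih s (hclosed _ (by rwa [mul_add, mul_one, ← add_assoc] at hs))
    refine μ.gap_notMem_betaSet j (hiter d _ ?_)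
    rw [← hd, add_comm, μ.hookNumber_eq hmem, mem_betaSet]
    have hi := mem_iff_lt_colLen.1 ((mem_cells _).1 hmem)
    exact ⟨i, hi.trans_le (μ.colLen_anti 0 j (Nat.zero_le j)), rfl⟩

theorem zero_notMem_betaSet : 0 ∉ μ.betaSet := by
  rw [mem_betaSet]
  rintro ⟨i, hi, h⟩
  have := μ.lt_rowLen_iff_lt_colLen (i := i) (j := 0)
  rw [beta] at h
  omega

theorem beta_lt_beta {i j : ℕ} (hij : i < j) (hj : j < μ.colLen 0) : μ.beta j < μ.beta i := by
  have := μ.rowLen_anti i j hij.le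
  rw [beta, beta]
  omega

theorem beta_injOn : Set.InjOn μ.beta (Finset.range (μ.colLen 0)) := by
  intro i hi j hj h
  simp only [Finset.coe_range, Set.mem_Iio] at hi hj
  rcases lt_trichotomy i j with hij | hij | hij
  · exact absurd h (μ.beta_lt_beta hij hj).ne'
  · exact hij
  · exact absurd h (μ.beta_lt_beta hij hi).ne

theorem card_betaSet : μ.betaSet.card = μ.colLen 0 := by
  rw [betaSet, Finset.card_image_of_injOn μ.beta_injOn, Finset.card_range]

theorem card_eq_sum_rowLen : μ.card = ∑ i ∈ Finset.range (μ.colLen 0), μ.rowLen i := by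
  rw [YoungDiagram.card, Finset.card_eq_sum_card_fiberwise (f := Prod.fst)
    (t := Finset.range (μ.colLen 0))]
  · exact Finset.sum_congr rfl fun i _ => μ.rowLen_eq_card.symm
  · rintro ⟨i, j⟩ h
    have hi := mem_iff_lt_colLen.1 ((mem_cells _).1 h)
    simpa using hi.trans_le (μ.colLen_anti 0 j (Nat.zero_le j))

theorem card_add_sum_range :
    μ.card + ∑ i ∈ Finset.range μ.betaSet.card, i = ∑ s ∈ μ.betaSet, s := by
  rw [card_betaSet, card_eq_sum_rowLen, betaSet, Finset.sum_image μ.beta_injOn,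
    ← Finset.sum_range_reflect fun i => i, ← Finset.sum_add_distrib]
  rfl

theorem eq_of_betaSet_eq {μ ν : YoungDiagram} (h : μ.betaSet = ν.betaSet) : μ = ν := by
  have hcol : μ.colLen 0 = ν.colLen 0 := by rw [← card_betaSet, h, card_betaSet]
  have hmono : ∀ (ξ : YoungDiagram) (r : ℕ), ξ.colLen 0 = r →
      StrictMono fun i : Fin r => ξ.beta (r - 1 - i) := by
    intro ξ r hr i j hij
    refine ξ.beta_lt_beta ?_ ?_ <;> omega
  have hmem : ∀ (ξ : YoungDiagram) (r : ℕ), ξ.colLen 0 = r →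
      ∀ i : Fin r, ξ.beta (r - 1 - i) ∈ ξ.betaSet :=
    fun ξ r hr i => ξ.mem_betaSet.2 ⟨_, by omega, rfl⟩
  have h1 := Finset.orderEmbOfFin_unique μ.card_betaSet (hmem μ _ rfl) (hmono μ _ rfl)
  have h2 := Finset.orderEmbOfFin_unique μ.card_betaSet
    (fun i => h ▸ hmem ν _ hcol.symm i) (hmono ν _ hcol.symm)
  have hrow : ∀ i, μ.rowLen i = ν.rowLen i := by
    intro i
    by_cases hi : i < μ.colLen 0
    · have := congrFun (h1.trans h2.symm) ⟨μ.colLen 0 - 1 - i, by omega⟩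
      simp only [beta] at this
      rw [show μ.colLen 0 - 1 - (μ.colLen 0 - 1 - i) = i by omega] at this
      omega
    · have := μ.lt_rowLen_iff_lt_colLen (i := i) (j := 0)
      have := ν.lt_rowLen_iff_lt_colLen (i := i) (j := 0)
      omega
  ext ⟨i, j⟩
  rw [mem_cells, mem_cells, mem_iff_lt_rowLen, mem_iff_lt_rowLen, hrow]

/-- With S listed increasingly as b, the rows are b(m) - m. As 0 ∉ S, b(m) > m, so no row is empty
and the first column has length |S|. -/
theorem exists_betaSet_eq {S : Finset ℕ} (hS : 0 ∉ S) : ∃ μ : YoungDiagram, μ.betaSet = S := by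
  set r := S.card with hr
  set b := S.orderEmbOfFin hr.symm with hb
  have hlow : ∀ (m : ℕ) (hm : m < r), m < b ⟨m, hm⟩ := by
    intro m
    induction m with
    | zero =>
      intro hm
      refine Nat.pos_of_ne_zero fun h => hS ?_
      rw [← h]
      exact S.orderEmbOfFin_mem _ _
    | succ m ih =>
      intro hm
      have h1 := ih (by omega)
      have h2 : b ⟨m, by omega⟩ < b ⟨m + 1, hm⟩ := b.strictMono (by simp)
      omega
  have hstep : ∀ (m l : ℕ) (hl : l < r) (hml : m ≤ l),
      b ⟨m, by omega⟩ + (l - m) ≤ b ⟨l, hl⟩ := by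
    intro m l
    induction l with
    | zero => intro hl hml; simp [show m = 0 by omega]
    | succ l ih =>
      intro hl hml
      rcases hml.lt_or_eq with h | h
      · have h1 := ih (by omega) (by omega)
        have h2 : b ⟨l, by omega⟩ < b ⟨l + 1, hl⟩ := b.strictMono (by simp)
        omega
      · subst h
        simp
  let w : List ℕ := List.ofFn fun i : Fin r =>
    b ⟨r - 1 - i, by omega⟩ - (r - 1 - i)
  have hw : w.SortedGE := by
    rw [List.sortedGE_ofFn_iff]
    intro i j hij
    have := hstep (r - 1 - j) (r - 1 - i) (by omega) (by omega)
    have := hlow (r - 1 - j) (by omega)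
    simp only
    omega
  have hlen : w.length = r := List.length_ofFn
  have hpos : ∀ x ∈ w, 0 < x := by
    intro x hx
    rw [List.mem_ofFn] at hx
    obtain ⟨i, rfl⟩ := hx
    have := hlow (r - 1 - i) (by omega)
    omega
  refine ⟨ofRowLens w hw, ?_⟩
  have hcol : (ofRowLens w hw).colLen 0 = r := by
    rw [← length_rowLens, rowLens_length_ofRowLens hpos, hlen]
  refine Finset.eq_of_subset_of_card_le ?_ ?_
  · intro s hs
    obtain ⟨i, hi, rfl⟩ := (mem_betaSet _).1 hs
    have h1 := rowLen_ofRowLens (hw := hw) ⟨i, by omega⟩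
    simp only at h1
    have h2 := hlow (r - 1 - i) (by omega)
    have h3 : w[i]'(by omega) = b ⟨r - 1 - i, by omega⟩ - (r - 1 - i) := by
      simp [w]
    rw [beta, hcol]
    have h4 : (ofRowLens w hw).rowLen i + (r - 1 - i) = b ⟨r - 1 - i, by omega⟩ := by
      rw [h1]
      simp only [Fin.getElem_fin]
      omega
    rw [h4]
    exact S.orderEmbOfFin_mem _ _
  · rw [card_betaSet, hcol]

end YoungDiagram

/-! ### Parametrization of 3-cores by pairs of naturals. -/

/-- The set of first-column hook lengths of the `3`-core with `m.1` such hook lengths congruent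
to `1` and `m.2` congruent to `2` modulo `3`. -/
def coreBetaSet (m : ℕ × ℕ) : Finset ℕ :=
  (Finset.range m.1).image (fun i => 3 * i + 1) ∪ (Finset.range m.2).image fun i => 3 * i + 2

theorem mem_coreBetaSet {m : ℕ × ℕ} {s : ℕ} :
    s ∈ coreBetaSet m ↔ (∃ i < m.1, 3 * i + 1 = s) ∨ ∃ i < m.2, 3 * i + 2 = s := by
  simp [coreBetaSet]

theorem zero_notMem_coreBetaSet (m : ℕ × ℕ) : 0 ∉ coreBetaSet m := by
  simp [mem_coreBetaSet]

theorem mem_coreBetaSet_of_add_three {m : ℕ × ℕ} {s : ℕ} (h : s + 3 ∈ coreBetaSet m) :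
    s ∈ coreBetaSet m := by
  rw [mem_coreBetaSet] at h ⊢
  rcases h with ⟨i, hi, h⟩ | ⟨i, hi, h⟩
  · exact Or.inl ⟨i - 1, by omega, by omega⟩
  · exact Or.inr ⟨i - 1, by omega, by omega⟩

theorem coreBetaSet_injective : Function.Injective coreBetaSet := by
  intro m m' h
  have h1 : ∀ i, i < m.1 ↔ i < m'.1 := by
    intro i
    have := Finset.ext_iff.1 h (3 * i + 1)
    rw [mem_coreBetaSet, mem_coreBetaSet] at this
    constructor
    · intro hi
      rcases this.1 (Or.inl ⟨i, hi, rfl⟩) with ⟨j, hj, hij⟩ | ⟨j, hj, hij⟩ <;> omega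
    · intro hi
      rcases this.2 (Or.inl ⟨i, hi, rfl⟩) with ⟨j, hj, hij⟩ | ⟨j, hj, hij⟩ <;> omega
  have h2 : ∀ i, i < m.2 ↔ i < m'.2 := by
    intro i
    have := Finset.ext_iff.1 h (3 * i + 2)
    rw [mem_coreBetaSet, mem_coreBetaSet] at this
    constructor
    · intro hi
      rcases this.1 (Or.inr ⟨i, hi, rfl⟩) with ⟨j, hj, hij⟩ | ⟨j, hj, hij⟩ <;> omega
    · intro hi
      rcases this.2 (Or.inr ⟨i, hi, rfl⟩) with ⟨j, hj, hij⟩ | ⟨j, hj, hij⟩ <;> omega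
  have e1 := h1 m.1
  have e2 := h1 m'.1
  have e3 := h2 m.2
  have e4 := h2 m'.2
  ext <;> omega

theorem exists_lt_iff_mem {S : Finset ℕ} (hS : ∀ s, s + 3 ∈ S → s ∈ S) (c : ℕ) :
    ∃ a, ∀ i, i < a ↔ 3 * i + c ∈ S := by
  have hex : ∃ a, 3 * a + c ∉ S := by
    by_contra! h
    refine Set.infinite_of_injective_forall_mem (f := fun a => 3 * a + c) ?_ h S.finite_toSet
    intro a b hab
    simp only at hab
    omega
  refine ⟨Nat.find hex, fun i => ⟨fun hi => not_not.1 (Nat.find_min hex hi), fun hi => ?_⟩⟩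
  by_contra! hle
  have hdown : ∀ d, 3 * (Nat.find hex + d) + c ∈ S → 3 * Nat.find hex + c ∈ S := by
    intro d
    induction d with
    | zero => exact id
    | succ d ih => exact fun h => ih (hS _ (by convert h using 1; ring))
  exact Nat.find_spec hex (hdown (i - Nat.find hex) (by rwa [Nat.add_sub_cancel' hle]))

/-- S meets each class mod 3 in an initial segment, which is empty for class 0. -/
theorem exists_coreBetaSet_eq {S : Finset ℕ} (h0 : 0 ∉ S) (hS : ∀ s, s + 3 ∈ S → s ∈ S) :
    ∃ m, coreBetaSet m = S := by
  obtain ⟨a, ha⟩ := exists_lt_iff_mem hS 1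
  obtain ⟨b, hb⟩ := exists_lt_iff_mem hS 2
  obtain ⟨c, hc⟩ := exists_lt_iff_mem hS 0
  have hc0 : ∀ i, 3 * i ∉ S := by
    intro i hi
    have h1 := (hc i).2 hi
    exact h0 ((hc 0).1 (by omega))
  refine ⟨(a, b), ?_⟩
  ext s
  rw [mem_coreBetaSet]
  constructor
  · rintro (⟨i, hi, rfl⟩ | ⟨i, hi, rfl⟩)
    · exact (ha i).1 hi
    · exact (hb i).1 hi
  · intro hs
    have hcases : s = 3 * (s / 3) ∨ s = 3 * (s / 3) + 1 ∨ s = 3 * (s / 3) + 2 := by omega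
    rcases hcases with h | h | h
    · exact absurd (h ▸ hs) (hc0 _)
    · exact Or.inl ⟨s / 3, (ha _).2 (h ▸ hs), h.symm⟩
    · exact Or.inr ⟨s / 3, (hb _).2 (h ▸ hs), h.symm⟩

theorem disjoint_coreBetaSet (m : ℕ × ℕ) :
    Disjoint ((Finset.range m.1).image (fun i => 3 * i + 1))
      ((Finset.range m.2).image fun i => 3 * i + 2) := by
  rw [Finset.disjoint_left]
  intro s hs hs'
  simp only [Finset.mem_image, Finset.mem_range] at hs hs'
  obtain ⟨i, _, rfl⟩ := hs
  obtain ⟨j, _, h⟩ := hs'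
  omega

theorem card_coreBetaSet (m : ℕ × ℕ) : (coreBetaSet m).card = m.1 + m.2 := by
  rw [coreBetaSet, Finset.card_union_of_disjoint (disjoint_coreBetaSet m),
    Finset.card_image_of_injective _ fun a b h => by simpa using h,
    Finset.card_image_of_injective _ fun a b h => by simpa using h, Finset.card_range,
    Finset.card_range]

theorem two_mul_sum_range_three_mul_add (a c : ℕ) :
    2 * ((∑ i ∈ Finset.range a, (3 * i + c) : ℕ) : ℤ) = 3 * a ^ 2 - 3 * a + 2 * c * a := by
  induction a with
  | zero => simp
  | succ a ih =>
    rw [Finset.sum_range_succ]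
    push_cast at ih ⊢
    linear_combination ih

theorem two_mul_sum_range_id (a : ℕ) :
    2 * ((∑ i ∈ Finset.range a, i : ℕ) : ℤ) = (a : ℤ) ^ 2 - a := by
  induction a with
  | zero => simp
  | succ a ih =>
    rw [Finset.sum_range_succ]
    push_cast at ih ⊢
    linear_combination ih

theorem two_mul_sum_coreBetaSet (m : ℕ × ℕ) : 2 * ((∑ s ∈ coreBetaSet m, s : ℕ) : ℤ) =
    3 * m.1 ^ 2 - m.1 + 3 * m.2 ^ 2 + m.2 := by
  rw [coreBetaSet, Finset.sum_union (disjoint_coreBetaSet m),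
    Finset.sum_image fun a _ b _ h => by simpa using h,
    Finset.sum_image fun a _ b _ h => by simpa using h]
  have h1 := two_mul_sum_range_three_mul_add m.1 1
  have h2 := two_mul_sum_range_three_mul_add m.2 2
  push_cast at h1 h2 ⊢
  linear_combination h1 + h2

/-- The size of the `3`-core with parameters `v`. -/
def coreForm (v : ℤ × ℤ) : ℤ := v.1 ^ 2 - v.1 * v.2 + v.2 ^ 2 + v.2

theorem card_eq_coreForm {μ : YoungDiagram} {m : ℕ × ℕ} (h : μ.betaSet = coreBetaSet m) :
    (μ.card : ℤ) = coreForm (m.1, m.2) := by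
  have h1 := μ.card_add_sum_range
  rw [h, card_coreBetaSet] at h1
  have h2 := two_mul_sum_coreBetaSet m
  have h3 := two_mul_sum_range_id (m.1 + m.2)
  zify at h1
  push_cast at h1 h2 h3
  refine mul_left_cancel₀ (two_ne_zero (α := ℤ)) ?_
  rw [coreForm]
  linear_combination 2 * h1 + h2 - h3

theorem exists_core_parametrization : ∃ g : ℕ × ℕ → YoungDiagram, Function.Injective g ∧
    (∀ μ, IsTCore 3 μ ↔ μ ∈ Set.range g) ∧ ∀ m, ((g m).card : ℤ) = coreForm (m.1, m.2) := by
  choose g hg using fun m => YoungDiagram.exists_betaSet_eq (zero_notMem_coreBetaSet m)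
  refine ⟨g, fun m m' h => coreBetaSet_injective (by rw [← hg, ← hg, h]), fun μ => ?_,
    fun m => card_eq_coreForm (hg m)⟩
  rw [μ.isTCore_iff (by norm_num)]
  constructor
  · intro h
    obtain ⟨m, hm⟩ := exists_coreBetaSet_eq μ.zero_notMem_betaSet h
    exact ⟨m, YoungDiagram.eq_of_betaSet_eq (by rw [hg, hm])⟩
  · rintro ⟨m, rfl⟩ s hs
    rw [hg] at hs ⊢
    exact mem_coreBetaSet_of_add_three hs

/-! ### Generating function of 3-cores and the conclusion. -/

theorem coreForm_admissible : AdmissibleWeight fun v => 3 * coreForm v + 1 := by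
  have key : ∀ v : ℤ × ℤ,
      eisNorm (2 * v.2 + 1 - v.1, v.2 - 2 * v.1) = 3 * coreForm v + 1 := by
    intro v
    simp only [eisNorm, coreForm]
    ring
  refine ⟨fun v => (eisNorm_nonneg _).trans_eq (key v), fun n => ?_⟩
  refine (eisNorm_admissible.2 n).preimage
    (f := fun v : ℤ × ℤ => (2 * v.2 + 1 - v.1, v.2 - 2 * v.1)) ?_ |>.subset ?_
  · rintro ⟨a, b⟩ _ ⟨c, d⟩ _ h
    simp only [Prod.mk.injEq] at h ⊢
    omega
  · intro v h
    simpa only [Set.mem_preimage, Set.mem_ofPred_eq, key] using h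

/-- The generating function `∑ q ^ (3 |μ| + 1)` of `3`-cores. -/
noncomputable def thetaCore : ℚ⟦X⟧ :=
  theta {v : ℤ × ℤ | 0 ≤ v.1 ∧ 0 ≤ v.2} fun v => 3 * coreForm v + 1

theorem thetaC_one_eq_theta :
    thetaC 1 = theta Set.univ fun v : ℤ × ℤ => 3 * coreForm v + 1 := by
  refine (theta_congr (fun v => (2 * v.2 + 1 - v.1, v.2 - 2 * v.1))
    (fun v => ((v.1 - 2 * v.2 - 1) / 3, v.2 + 2 * ((v.1 - 2 * v.2 - 1) / 3)))
    ?_ ?_ ?_ ?_ ?_).symm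
  all_goals rintro ⟨x, y⟩ h
  all_goals simp only [Set.mem_ofPred_eq, Set.mem_univ, Prod.mk.injEq, eisNorm, coreForm] at h ⊢
  · omega
  · omega
  · omega
  · push_cast
    ring

/-- The affine map (x, y) ↦ (-y-1, x-y-1), of order three, preserves `coreForm` and cyclically
permutes the quadrant of cores and two other regions tiling ℤ². -/
theorem thetaC_one_eq_three_mul_thetaCore : thetaC 1 = 3 * thetaCore := by
  have h : (Set.univ : Set (ℤ × ℤ)) = {v : ℤ × ℤ | 0 ≤ v.1 ∧ 0 ≤ v.2} ∪
      ({v : ℤ × ℤ | v.1 < 0 ∧ v.1 ≤ v.2} ∪ {v : ℤ × ℤ | v.2 < 0 ∧ v.2 < v.1}) := by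
    ext v
    simp only [Set.mem_univ, Set.mem_union, Set.mem_ofPred_eq, true_iff]
    omega
  have h2 : theta {v : ℤ × ℤ | v.1 < 0 ∧ v.1 ≤ v.2} (fun v => 3 * coreForm v + 1) =
      thetaCore := by
    refine (theta_congr (fun v => (-v.2 - 1, v.1 - v.2 - 1)) (fun v => (v.2 - v.1, -v.1 - 1))
      ?_ ?_ ?_ ?_ ?_).symm
    all_goals rintro ⟨x, y⟩ h
    all_goals simp only [Set.mem_ofPred_eq, Prod.mk.injEq, coreForm] at h ⊢
    · omega
    · omega
    · omega
    · omega
    · ring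
  have h3 : theta {v : ℤ × ℤ | v.2 < 0 ∧ v.2 < v.1} (fun v => 3 * coreForm v + 1) =
      thetaCore := by
    refine theta_congr (fun v => (-v.2 - 1, v.1 - v.2 - 1)) (fun v => (v.2 - v.1, -v.1 - 1))
      ?_ ?_ ?_ ?_ ?_
    all_goals rintro ⟨x, y⟩ h
    all_goals simp only [Set.mem_ofPred_eq, Prod.mk.injEq, coreForm] at h ⊢
    · omega
    · omega
    · omega
    · omega
    · ring
  rw [thetaC_one_eq_theta, h, theta_union coreForm_admissible, theta_union coreForm_admissible,
    h2, h3, ← thetaCore]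
  · ring
  all_goals
    rw [Set.disjoint_left]
    intro v h h'
    simp only [Set.mem_ofPred_eq, Set.mem_union] at h h'
    omega

theorem coreTripleCount_eq_coeff (n : ℕ) :
    (coreTripleCount 3 n : ℚ) = coeff (3 * n + 3) (thetaCore ^ 3) := by
  obtain ⟨g, hinj, hcore, hcard⟩ := exists_core_parametrization
  have ha := coreForm_admissible
  rw [pow_three', thetaCore, theta_mul_mul ha ha ha, coeff_theta, coreTripleCount, Nat.cast_inj]
  symm
  refine Set.ncard_congr (fun p _ => ![g (p.1.1.toNat, p.1.2.toNat),
    g (p.2.1.1.toNat, p.2.1.2.toNat), g (p.2.2.1.toNat, p.2.2.2.toNat)]) ?_ ?_ ?_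
  · rintro ⟨⟨a, b⟩, ⟨c, d⟩, e, f⟩ ⟨⟨⟨ha, hb⟩, ⟨hc, hd⟩, he, hf⟩, h⟩
    simp only at ha hb hc hd he hf h
    lift a to ℕ using ha
    lift b to ℕ using hb
    lift c to ℕ using hc
    lift d to ℕ using hd
    lift e to ℕ using he
    lift f to ℕ using hf
    refine ⟨?_, fun i => (hcore _).2 ?_⟩
    · have h1 := hcard (a, b)
      have h2 := hcard (c, d)
      have h3 := hcard (e, f)
      simp only [Fin.sum_univ_three, Matrix.cons_val, Int.toNat_natCast]
      zify
      push_cast at h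
      linarith
    · fin_cases i <;> exact ⟨_, rfl⟩
  · rintro ⟨⟨a, b⟩, ⟨c, d⟩, e, f⟩ ⟨⟨a', b'⟩, ⟨c', d'⟩, e', f'⟩
      ⟨⟨⟨ha, hb⟩, ⟨hc, hd⟩, he, hf⟩, _⟩ ⟨⟨⟨ha', hb'⟩, ⟨hc', hd'⟩, he', hf'⟩, _⟩ h
    have h0 := hinj (congrFun h 0)
    have h1 := hinj (congrFun h 1)
    have h2 := hinj (congrFun h 2)
    simp only [Prod.mk.injEq] at *
    omega
  · rintro p ⟨hsum, hp⟩
    choose m hm using fun i => (hcore (p i)).1 (hp i)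
    refine ⟨(((m 0).1, (m 0).2), ((m 1).1, (m 1).2), ((m 2).1, (m 2).2)), ⟨by simp, ?_⟩, ?_⟩
    · have h1 := hcard (m 0)
      have h2 := hcard (m 1)
      have h3 := hcard (m 2)
      rw [hm] at h1 h2 h3
      rw [Fin.sum_univ_three] at hsum
      zify at hsum
      push_cast
      linarith
    · ext i : 1
      rw [← hm i]
      fin_cases i <;> simp

theorem mainTheorem9 (n : ℕ) :
    formRepresentationCount (12 * n + 2) = 12 * coreTripleCount 3 (6 * n) := by
  have h1 := coeff_thetaC_pow_three n
  have h2 : thetaC 1 ^ 3 = (27 : ℕ) * thetaCore ^ 3 := by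
    rw [thetaC_one_eq_three_mul_thetaCore]
    push_cast
    ring
  rw [h2, coeff_natCast_mul, show 18 * n + 3 = 3 * (6 * n) + 3 by ring,
    ← coreTripleCount_eq_coeff] at h1
  have h3 : (formRepresentationCount (12 * n + 2) : ℚ) = 12 * coreTripleCount 3 (6 * n) := by
    rw [formRepresentationCount_eq, coeff_thetaA_sq_mul_thetaA]
    push_cast at h1
    linear_combination (-4 / 9 : ℚ) * h1
  exact_mod_cast h3
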